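/- Let $n>1$ and let $M$ be a connected smooth manifold of dimension $2n+2$ with a Lorentz $\mathcal S$-structure $(\varphi,\xi_1,\xi_2,\eta^1,\eta^2,g)$ such that $\xi_1$ is timelike. This means the following (all data smooth). * $g$ is a Lorentz metric (a semi-Riemannian metric of index $1$), $\varphi$ is a nowhere vanishing $(1,1)$-tensor field of constant rank, $\xi_1,\xi_2$ are vector fields spanning $\ker\varphi$ at each point, and $\eta^1,\eta^2$ are $1$-forms with $\varphi^2=-I+\sum_\alpha\eta^\alpha\otimes\xi_\alpha$ and $\eta^\alpha(\xi_\beta)=\delta^\alpha_\beta$. * $g(\varphi X,\varphi Y)=g(X,Y)-\sum_\alpha\varepsilon_\alpha\eta^\alpha(X)\eta^\alpha(Y)$, where $\varepsilon_\alpha=1$ if $\xi_\alpha$ is spacelike and $\varepsilon_\alpha=-1$ if $\xi_\alpha$ is timelike. * $d\eta^\alpha(X,Y)=g(X,\varphi Y)$ for $\alpha=1,2$, and $N_\varphi+2\sum_\alpha d\eta^\alpha\otimes\xi_\alpha=0$, where $d\eta(X,Y)=\tfrac12\big(X\eta(Y)-Y\eta(X)-\eta([X,Y])\big)$ and $N_\varphi(X,Y)=[\varphi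 X,\varphi Y]-\varphi[\varphi X,Y]-\varphi[X,\varphi Y]+\varphi^2[X,Y]$. Let $R(X,Y)Z=\nabla_X\nabla_YZ-\nabla_Y\nabla_XZ-\nabla_{[X,Y]}Z$ be the curvature tensor of the Levi-Civita connection of $g$. For $p\in M$ let $$N_\varphi((\xi_1)_p)=\{(\xi_1)_p+x \mid x\in \operatorname{Im}\varphi_p,\ g(x,(\xi_1)_p)=0,\ g(x,x)=1\},$$ a set of null vectors. For $u\in N_\varphi((\xi_1)_p)$ let $\pi:u^\perp\to u^\perp/\operatorname{span}\{u\}$ be the projection and let $\bar R_u$ be the endomorphism $\pi(x)\mapsto\pi(R(x,u)u)$ of $u^\perp/\operatorname{span}\{u\}$. Let $\bar R_u|_{u^\perp\cap\operatorname{Im}\varphi}$ denote its restriction to $\pi(u^\perp\cap\operatorname{Im}\varphi_p)$. $M$ is called $\varphi$-null Osserman with respect to $\xi_1$ if for every $p\in M$ the characteristic polynomial of $\bar R_u$ is the same for all $u\in N_\varphi((\xi_1)_p)$. $M$ is an $\mathcal S$-space form with $\varphi$-sectional curvature $c$ if for every $p\in M$ and every $x\in\operatorname{Im}\varphi_p$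 with $g(x,x)\neq0$ the sectional curvature $$\frac{g(R(x,y)y,x)}{g(x,x)g(y,y)-g(x,y)^2},\qquad y=\varphi x,$$ of the plane $\operatorname{span}\{x,\varphi x\}$ equals $c$. Then the following are equivalent: 1. $M$ is $\varphi$-null Osserman with respect to $\xi_1$, and for all $p\in M$ and $u\in N_\varphi((\xi_1)_p)$ the operator $\bar R_u|_{u^\perp\cap\operatorname{Im}\varphi}$ has a single eigenvalue $\lambda$. 2. $M$ is an $\mathcal S$-space form with $\varphi$-sectional curvature $0$. Moreover, in this case $\lambda=1$ (for all $p$ and $u$). -/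

import Mathlib

open scoped Manifold ContDiff Topology

set_option maxSynthPendingDepth 3

noncomputable section

namespace LorentzS

section Coordinates

variable {E : Type*} [NormedAddCommGroup E] [NormedSpace ℝ E]

/-- Twice the Christoffel symbols of the first kind of a metric `h` given on (an open subset of) the
vector space `E`: `(v, w, z) ↦ D_v h(w, z) + D_w h(v, z) - D_z h(v, w)`. -/
def christoffelFirst (h : E → E →L[ℝ] E →L[ℝ] ℝ) (y : E) : E →L[ℝ] E →L[ℝ] E →L[ℝ] ℝ :=
  fderiv ℝ h y + (fderiv ℝ h y).flip -
    ((ContinuousLinearMap.flipₗᵢ ℝ E E ℝ).toContinuousLinearEquiv :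
      (E →L[ℝ] E →L[ℝ] ℝ) →L[ℝ] (E →L[ℝ] E →L[ℝ] ℝ)) ∘L (fderiv ℝ h y).flip

theorem christoffelFirst_apply (h : E → E →L[ℝ] E →L[ℝ] ℝ) (y v w z : E) :
    christoffelFirst h y v w z =
      fderiv ℝ h y v w z + fderiv ℝ h y w v z - fderiv ℝ h y z v w := by
  simp [christoffelFirst]

/-- The Christoffel symbols `Γ(v, w)` of the Levi-Civita connection of `h`, so that
`∇_V W = DW(V) + Γ(V, W)`. -/
def christoffel (h : E → E →L[ℝ] E →L[ℝ] ℝ) (y : E) : E →L[ℝ] E →L[ℝ] E :=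
  (2⁻¹ : ℝ) • (ContinuousLinearMap.compL ℝ E (E →L[ℝ] ℝ) E (h y).inverse) ∘L christoffelFirst h y

theorem christoffel_apply (h : E → E →L[ℝ] E →L[ℝ] ℝ) (y v w : E) :
    christoffel h y v w = (2⁻¹ : ℝ) • (h y).inverse (christoffelFirst h y v w) := by
  simp [christoffel]

/-- The curvature `R(a, b)c = ∇_a ∇_b c - ∇_b ∇_a c` of the Levi-Civita connection of `h`, computed
on the constant (hence commuting) vector fields `a, b, c` of `E`. -/
def coordCurvature (h : E → E →L[ℝ] E →L[ℝ] ℝ) (y a b c : E) : E :=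
  fderiv ℝ (christoffel h) y a b c - fderiv ℝ (christoffel h) y b a c
    + christoffel h y a (christoffel h y b c) - christoffel h y b (christoffel h y a c)

theorem coordCurvature_add (h : E → E →L[ℝ] E →L[ℝ] ℝ) (y a a' b c : E) :
    coordCurvature h y (a + a') b c = coordCurvature h y a b c + coordCurvature h y a' b c := by
  simp only [coordCurvature, map_add, add_apply]
  abel

theorem coordCurvature_smul (h : E → E →L[ℝ] E →L[ℝ] ℝ) (y : E) (r : ℝ) (a b c : E) :
    coordCurvature h y (r • a) b c = r • coordCurvature h y a b c := by
  simp only [coordCurvature, map_smul, smul_apply, smul_add, smul_sub]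

theorem coordCurvature_skew [CompleteSpace E] {h : E → E →L[ℝ] E →L[ℝ] ℝ} {y : E}
    (hh : ContDiffAt ℝ 2 h y)
    (hsymm : ∀ᶠ q in 𝓝 y, ∀ v w, h q v w = h q w v)
    (hinv : ∀ᶠ q in 𝓝 y, (h q).IsInvertible) (a b u : E) :
    h y (coordCurvature h y a b u) u = 0 := by
  have hd : ∀ᶠ q in 𝓝 y, ContDiffAt ℝ 2 h q := hh.eventually (by simp)
  have hDsymm : ∀ᶠ q in 𝓝 y, ∀ a v w, fderiv ℝ h q a v w = fderiv ℝ h q a w v := by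
    filter_upwards [hd, hsymm.eventually_nhds] with q hq hs a v w
    have hdq : DifferentiableAt ℝ h q := hq.differentiableAt (by norm_num)
    have e : (fun p => h p v w) =ᶠ[𝓝 q] fun p => h p w v := hs.mono fun p hp => hp v w
    have e' := congrArg (fun L : E →L[ℝ] ℝ => L a) (e.fderiv_eq (𝕜 := ℝ))
    have key : ∀ v w, fderiv ℝ (fun p => h p v w) q a = fderiv ℝ h q a v w := fun v w => by
      have := ((hdq.hasFDerivAt.clm_apply (hasFDerivAt_const v q)).clm_apply
        (hasFDerivAt_const w q)).fderiv
      rw [this]; simp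
    simpa only [key] using e'
  have hG : ∀ᶠ q in 𝓝 y, ∀ v w z, h q (christoffel h q v w) z =
      2⁻¹ * (fderiv ℝ h q v w z + fderiv ℝ h q w v z - fderiv ℝ h q z v w) := by
    filter_upwards [hinv] with q hq v w z
    rw [christoffel_apply, map_smul, hq.self_apply_inverse]
    simp [christoffelFirst_apply]
  have hGd : DifferentiableAt ℝ (christoffel h) y := by
    have h1 : ContDiffAt ℝ 1 (fderiv ℝ h) y := hh.fderiv_right (by norm_num)
    have h1' : DifferentiableAt ℝ (fderiv ℝ h) y := h1.differentiableAt (by norm_num)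
    have h2 : DifferentiableAt ℝ (fun q => (h q).inverse) y := by
      have := (hinv.self_of_nhds.contDiffAt_map_inverse (n := 1)).differentiableAt (by norm_num)
      exact this.comp y (hh.differentiableAt (by norm_num))
    have h3 : DifferentiableAt ℝ (christoffelFirst h) y := by
      unfold christoffelFirst
      have hf : DifferentiableAt ℝ (fun q => (fderiv ℝ h q).flip) y :=
        ((ContinuousLinearMap.flipₗᵢ ℝ E E (E →L[ℝ] ℝ)).toContinuousLinearEquiv.differentiableAt).comp
          y h1'
      exact (h1'.add hf).sub ((differentiableAt_const _).clm_comp hf)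
    unfold christoffel
    have h4 : DifferentiableAt ℝ
        (fun q => ContinuousLinearMap.compL ℝ E (E →L[ℝ] ℝ) E (h q).inverse) y :=
      (ContinuousLinearMap.compL ℝ E (E →L[ℝ] ℝ) E).differentiableAt.comp y h2
    exact (h4.clm_comp h3).fun_const_smul _
  have hhd : DifferentiableAt ℝ h y := hh.differentiableAt (by norm_num)
  have hDd : DifferentiableAt ℝ (fderiv ℝ h) y :=
    (hh.fderiv_right (m := 1) (by norm_num)).differentiableAt (by norm_num)
  -- the value of `h (D_b Γ(a, u)) u`
  have key : ∀ a b, h y (fderiv ℝ (christoffel h) y b a u) u +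
      h y (christoffel h y b (christoffel h y a u)) u =
      2⁻¹ * fderiv ℝ (fderiv ℝ h) y b a u u - h y (christoffel h y a u) (christoffel h y b u) := by
    intro a b
    have e : (fun q => h q (christoffel h q a u) u) =ᶠ[𝓝 y] fun q => 2⁻¹ * fderiv ℝ h q a u u := by
      filter_upwards [hG, hDsymm] with q hq hs
      rw [hq, hs u a u]; ring
    have l := ((hhd.hasFDerivAt.clm_apply ((hGd.hasFDerivAt.clm_apply (hasFDerivAt_const a y)).clm_apply
      (hasFDerivAt_const u y))).clm_apply (hasFDerivAt_const u y)).fderiv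
    have r := ((((hDd.hasFDerivAt.clm_apply (hasFDerivAt_const a y)).clm_apply
      (hasFDerivAt_const u y)).clm_apply (hasFDerivAt_const u y)).const_mul (2⁻¹ : ℝ)).fderiv
    have e' := e.fderiv_eq (𝕜 := ℝ)
    rw [l, r] at e'
    have e'' := congrArg (fun L : E →L[ℝ] ℝ => L b) e'
    simp at e''
    have m : fderiv ℝ h y b (christoffel h y a u) u =
        h y (christoffel h y b (christoffel h y a u)) u +
        h y (christoffel h y a u) (christoffel h y b u) := by
      rw [hsymm.self_of_nhds (christoffel h y a u) (christoffel h y b u), hG.self_of_nhds,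
        hG.self_of_nhds]
      have s := hDsymm.self_of_nhds
      rw [s b (christoffel h y a u) u]; ring
    linarith
  have hs2 : fderiv ℝ (fderiv ℝ h) y b a = fderiv ℝ (fderiv ℝ h) y a b :=
    (hh.isSymmSndFDerivAt (by simp)).eq b a
  have k1 := key a b
  have k2 := key b a
  rw [hs2] at k1
  have k3 := hsymm.self_of_nhds (christoffel h y a u) (christoffel h y b u)
  simp only [coordCurvature, map_add, map_sub, add_apply, sub_apply]
  linarith

end Coordinates

section Metric

variable (E : Type*) [NormedAddCommGroup E] [NormedSpace ℝ E]
  (M : Type*) [TopologicalSpace M] [ChartedSpace E M] [IsManifold 𝓘(ℝ, E) ∞ M]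

/-- A semi-Riemannian metric on a smooth manifold `M` modelled on `E`. -/
structure SemiRiemannianMetric where
  /-- the scalar product on each tangent space -/
  val : ∀ p : M, TangentSpace 𝓘(ℝ, E) p →L[ℝ] TangentSpace 𝓘(ℝ, E) p →L[ℝ] ℝ
  symm : ∀ (p : M) (v w : TangentSpace 𝓘(ℝ, E) p), val p v w = val p w v
  nondegenerate : ∀ (p : M) (v : TangentSpace 𝓘(ℝ, E) p), (∀ w, val p v w = 0) → v = 0
  contMDiff : ContMDiff 𝓘(ℝ, E) (𝓘(ℝ, E).prod 𝓘(ℝ, E →L[ℝ] E →L[ℝ] ℝ)) ∞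
    (fun p => Bundle.TotalSpace.mk' (E →L[ℝ] E →L[ℝ] ℝ)
      (E := fun p : M => TangentSpace 𝓘(ℝ, E) p →L[ℝ] TangentSpace 𝓘(ℝ, E) p →L[ℝ] ℝ) p (val p))

variable {E M}

instance tangentSpace_finiteDimensional [FiniteDimensional ℝ E] (p : M) :
    FiniteDimensional ℝ (TangentSpace 𝓘(ℝ, E) p) :=
  inferInstanceAs (FiniteDimensional ℝ E)

namespace SemiRiemannianMetric

variable (g : SemiRiemannianMetric E M)

/-- The quadratic form `v ↦ g_p(v, v)`. -/
def quadraticForm (p : M) : QuadraticForm ℝ (TangentSpace 𝓘(ℝ, E) p) :=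
  LinearMap.BilinMap.toQuadraticMap
    ((ContinuousLinearMap.coeLM ℝ).comp (g.val p).toLinearMap)

/-- A Lorentz metric is a semi-Riemannian metric of index `1`. -/
def IsLorentz : Prop := ∀ p, sigNeg (g.quadraticForm p) = 1

/-- The metric read in the chart at `p`: its value at `y` is the pull-back of `g_q`, `q` the point with coordinates `y`, by the differential
`E → T_q M` of the inverse of the chart. -/
def inChart (p : M) (y : E) : E →L[ℝ] E →L[ℝ] ℝ :=
  let q : M := (extChartAt 𝓘(ℝ, E) p).symm y
  let L : E →L[ℝ] TangentSpace 𝓘(ℝ, E) q :=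
    (trivializationAt E (TangentSpace 𝓘(ℝ, E)) p).symmL ℝ q
  (L.precomp ℝ) ∘L (g.val q) ∘L L

theorem inChart_apply (p : M) (y v w : E) :
    g.inChart p y v w = g.val ((extChartAt 𝓘(ℝ, E) p).symm y)
      ((trivializationAt E (TangentSpace 𝓘(ℝ, E)) p).symmL ℝ _ v)
      ((trivializationAt E (TangentSpace 𝓘(ℝ, E)) p).symmL ℝ _ w) := rfl

theorem symmL_self (p : M) (v : E) :
    (trivializationAt E (TangentSpace 𝓘(ℝ, E)) p).symmL ℝ p v = v := by
  rw [TangentBundle.symmL_trivializationAt_eq_core (mem_chart_source E p)]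
  exact (tangentBundleCore 𝓘(ℝ, E) M).coordChange_self (achart E p) p (mem_chart_source E p) v

theorem inChart_self (p : M) (v w : E) :
    g.inChart p (extChartAt 𝓘(ℝ, E) p p) v w = g.val p v w := by
  have h : ∀ q : M, q = p → g.val q
      ((trivializationAt E (TangentSpace 𝓘(ℝ, E)) p).symmL ℝ q v)
      ((trivializationAt E (TangentSpace 𝓘(ℝ, E)) p).symmL ℝ q w) = g.val p v w := by
    rintro q rfl
    rw [symmL_self, symmL_self]
  rw [inChart_apply]
  exact h _ (extChartAt_to_inv p)

theorem inChart_symm (p : M) (y v w : E) : g.inChart p y v w = g.inChart p y w v :=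
  g.symm _ _ _

theorem inChart_isInvertible [FiniteDimensional ℝ E] (p : M) {y : E}
    (hy : y ∈ (extChartAt 𝓘(ℝ, E) p).target) : (g.inChart p y).IsInvertible := by
  have hq : (extChartAt 𝓘(ℝ, E) p).symm y ∈
      (trivializationAt E (TangentSpace 𝓘(ℝ, E)) p).baseSet := by
    simpa using (extChartAt 𝓘(ℝ, E) p).map_target hy
  set e := (trivializationAt E (TangentSpace 𝓘(ℝ, E)) p) with he
  have hinj : Function.Injective (g.inChart p y) := by
    rw [injective_iff_map_eq_zero]
    intro v hv
    have h0 : e.symmL ℝ ((extChartAt 𝓘(ℝ, E) p).symm y) v = 0 := by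
      apply g.nondegenerate
      intro w
      have h1 := g.inChart_apply p y v
        (e.continuousLinearMapAt ℝ ((extChartAt 𝓘(ℝ, E) p).symm y) w)
      have h2 := e.symmL_continuousLinearMapAt (R := ℝ) hq w
      rw [show g.val _ _ _ = g.val _ _ w from congrArg _ h2] at h1
      rw [← h1, hv]
      rfl
    have h2 := e.continuousLinearMapAt_symmL (R := ℝ) hq v
    rw [h0, map_zero] at h2
    exact h2.symm
  have hdim : Module.finrank ℝ E = Module.finrank ℝ (E →L[ℝ] ℝ) := by
    rw [← LinearMap.toContinuousLinearMap.finrank_eq]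
    exact (Subspace.dual_finrank_eq (K := ℝ) (V := E)).symm
  refine ⟨(LinearEquiv.ofInjectiveOfFinrankEq (g.inChart p y).toLinearMap hinj
    hdim).toContinuousLinearEquiv, ?_⟩
  ext v w
  rfl

theorem inChart_contDiffOn [FiniteDimensional ℝ E] (p : M) :
    ContDiffOn ℝ ∞ (g.inChart p) (extChartAt 𝓘(ℝ, E) p).target := by
  rw [contDiffOn_clm_apply]
  intro v
  rw [contDiffOn_clm_apply]
  intro w
  have hs : ∀ v : E, ContMDiffOn 𝓘(ℝ, E) (𝓘(ℝ, E).prod 𝓘(ℝ, E)) ∞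
      (fun q : M => Bundle.TotalSpace.mk' E q
        ((trivializationAt E (TangentSpace 𝓘(ℝ, E)) p).symmL ℝ q v))
      (extChartAt 𝓘(ℝ, E) p).source := by
    intro v
    have hb : (extChartAt 𝓘(ℝ, E) p).source =
        (trivializationAt E (TangentSpace 𝓘(ℝ, E)) p).baseSet := by simp
    rw [hb, (trivializationAt E (TangentSpace 𝓘(ℝ, E)) p).contMDiffOn_section_baseSet_iff]
    refine (contMDiffOn_const (c := v)).congr fun q hq => ?_
    have := (trivializationAt E (TangentSpace 𝓘(ℝ, E)) p).continuousLinearMapAt_symmL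
      (R := ℝ) hq v
    rw [Bundle.Trivialization.continuousLinearMapAt_apply,
      Bundle.Trivialization.coe_linearMapAt_of_mem _ hq] at this
    exact this
  have h1 : ContMDiffOn 𝓘(ℝ, E) 𝓘(ℝ, ℝ) ∞ (fun q : M => g.val q
      ((trivializationAt E (TangentSpace 𝓘(ℝ, E)) p).symmL ℝ q v)
      ((trivializationAt E (TangentSpace 𝓘(ℝ, E)) p).symmL ℝ q w))
      (extChartAt 𝓘(ℝ, E) p).source := by
    intro q hq
    have h3 := (g.contMDiff.contMDiffOn.clm_bundle_apply₂ (F₃ := ℝ) (E₃ := Bundle.Trivial M ℝ)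
      (hs v) (hs w)) q hq
    rw [Bundle.contMDiffWithinAt_section] at h3
    exact h3
  have h2 := h1.comp (contMDiffOn_extChartAt_symm (n := ∞) (I := 𝓘(ℝ, E)) p)
    (extChartAt 𝓘(ℝ, E) p).symm.mapsTo
  exact h2.contDiffOn

/-- The curvature tensor `R(x, y)z = ∇_x ∇_y z - ∇_y ∇_x z - ∇_{[x, y]} z` of the Levi-Civita
connection at `p`, computed in the chart at `p`, by which `T_p M` is identified with `E`. -/
def curvature (p : M) (x y z : TangentSpace 𝓘(ℝ, E) p) : TangentSpace 𝓘(ℝ, E) p :=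
  coordCurvature (E := E) (g.inChart p) (extChartAt 𝓘(ℝ, E) p p) x y z

/-- The linear map `x ↦ R(x, u)u`. -/
def jacobi (p : M) (u : TangentSpace 𝓘(ℝ, E) p) :
    TangentSpace 𝓘(ℝ, E) p →ₗ[ℝ] TangentSpace 𝓘(ℝ, E) p where
  toFun x := g.curvature p x u u
  map_add' x y := coordCurvature_add (E := E) _ _ x y u u
  map_smul' c x := coordCurvature_smul (E := E) _ _ c x u u

/-- The orthogonal complement `u^⊥` of `u` in `T_p M`. -/
def orth (p : M) (u : TangentSpace 𝓘(ℝ, E) p) : Submodule ℝ (TangentSpace 𝓘(ℝ, E) p) :=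
  LinearMap.ker (g.val p u).toLinearMap

theorem jacobi_self (p : M) (u : TangentSpace 𝓘(ℝ, E) p) : g.jacobi p u u = 0 := by
  change coordCurvature (E := E) _ _ u u u = 0
  simp [coordCurvature]

variable [FiniteDimensional ℝ E]

theorem jacobi_mem_orth (p : M) (u x : TangentSpace 𝓘(ℝ, E) p) : g.jacobi p u x ∈ g.orth p u := by
  have ht : (extChartAt 𝓘(ℝ, E) p).target ∈ 𝓝 (extChartAt 𝓘(ℝ, E) p p) :=
    extChartAt_target_mem_nhds p
  have := coordCurvature_skew (h := g.inChart p) (y := extChartAt 𝓘(ℝ, E) p p)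
    (((g.inChart_contDiffOn p).contDiffAt ht).of_le (WithTop.coe_le_coe.2 (le_top : (2 : ℕ∞) ≤ ⊤)))
    (Filter.Eventually.of_forall fun q v w => g.inChart_symm p q v w)
    (Filter.mem_of_superset ht fun q hq => g.inChart_isInvertible p hq) x u u
  have this := (g.inChart_self p _ _).symm.trans this
  change g.val p u (g.jacobi p u x) = 0
  rw [g.symm]
  exact this

/-- The quotient `u^⊥ / span{u}` (for `u` a null vector, `span{u} ⊆ u^⊥`). -/
abbrev OrthQuotient (p : M) (u : TangentSpace 𝓘(ℝ, E) p) : Type _ :=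
  g.orth p u ⧸ (Submodule.span ℝ {u}).submoduleOf (g.orth p u)

/-- The Jacobi operator `R̄_u : u^⊥ / span{u} → u^⊥ / span{u}`, `x̄ ↦ π(R(x, u)u)`. -/
def jacobiBar (p : M) (u : TangentSpace 𝓘(ℝ, E) p) :
    g.OrthQuotient p u →ₗ[ℝ] g.OrthQuotient p u :=
  Submodule.mapQ _ _ ((g.jacobi p u).restrict fun x _ => g.jacobi_mem_orth p u x) <| by
    intro x hx
    obtain ⟨c, hc⟩ := Submodule.mem_span_singleton.1 (Submodule.mem_comap.1 hx)
    have h0 : g.jacobi p u (x : TangentSpace 𝓘(ℝ, E) p) = 0 := by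
      rw [show (x : TangentSpace 𝓘(ℝ, E) p) = c • u from hc.symm, map_smul, jacobi_self, smul_zero]
    have h1 : ((g.jacobi p u).restrict fun x _ => g.jacobi_mem_orth p u x) x = 0 :=
      Subtype.ext h0
    rw [Submodule.mem_comap, h1]
    exact Submodule.zero_mem _

/-- The sectional curvature of the plane spanned by `x, y`, where
`Δ = g(x, x) g(y, y) - g(x, y)²` is supposed to be non-zero. -/
def sectionalCurvature (p : M) (x y : TangentSpace 𝓘(ℝ, E) p) : ℝ :=
  g.val p (g.curvature p x y y) x / (g.val p x x * g.val p y y - g.val p x y ^ 2)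

end SemiRiemannianMetric
end Metric

section Structures

variable (E : Type*) [NormedAddCommGroup E] [NormedSpace ℝ E]
  (M : Type*) [TopologicalSpace M] [ChartedSpace E M] [IsManifold 𝓘(ℝ, E) ∞ M] (s : ℕ)

/-- A globally framed `f`-structure (`g.f.f`-structure) with `s` characteristic vector fields on a
smooth manifold `M` modelled on `E`. -/
structure GFFStructure where
  /-- the `(1,1)`-tensor field `φ` -/
  φ : ∀ p : M, TangentSpace 𝓘(ℝ, E) p →L[ℝ] TangentSpace 𝓘(ℝ, E) p
  /-- the characteristic vector fields `ξ_α` -/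
  ξ : Fin s → ∀ p : M, TangentSpace 𝓘(ℝ, E) p
  /-- the 1-forms `η^α` -/
  η : Fin s → ∀ p : M, TangentSpace 𝓘(ℝ, E) p →L[ℝ] ℝ
  φ_contMDiff : ContMDiff 𝓘(ℝ, E) (𝓘(ℝ, E).prod 𝓘(ℝ, E →L[ℝ] E)) ∞
    (fun p => Bundle.TotalSpace.mk' (E →L[ℝ] E)
      (E := fun p : M => TangentSpace 𝓘(ℝ, E) p →L[ℝ] TangentSpace 𝓘(ℝ, E) p) p (φ p))
  ξ_contMDiff : ∀ α, ContMDiff 𝓘(ℝ, E) (𝓘(ℝ, E).prod 𝓘(ℝ, E)) ∞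
    (fun p => Bundle.TotalSpace.mk' E (E := fun p : M => TangentSpace 𝓘(ℝ, E) p) p (ξ α p))
  η_contMDiff : ∀ α, ContMDiff 𝓘(ℝ, E) (𝓘(ℝ, E).prod 𝓘(ℝ, E →L[ℝ] ℝ)) ∞
    (fun p => Bundle.TotalSpace.mk' (E →L[ℝ] ℝ)
      (E := fun p : M => TangentSpace 𝓘(ℝ, E) p →L[ℝ] ℝ) p (η α p))
  φ_ne_zero : ∀ p, φ p ≠ 0
  φ_rank : ∀ p q, Module.finrank ℝ (φ p).range = Module.finrank ℝ (φ q).range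
  ker_φ : ∀ p, (φ p).ker = Submodule.span ℝ (Set.range fun α => ξ α p)
  φ_φ : ∀ p (x : TangentSpace 𝓘(ℝ, E) p), φ p (φ p x) = -x + ∑ α, η α p x • ξ α p
  η_ξ : ∀ p α β, η α p (ξ β p) = if α = β then 1 else 0

/-- An indefinite `g.f.f`-structure: a `g.f.f`-structure together with a compatible semi-Riemannian
metric. -/
structure IndefiniteGFFStructure extends GFFStructure E M s where
  /-- the metric -/
  g : SemiRiemannianMetric E M
  /-- the signs `ε_α = ± 1`, according to whether `ξ_α` is spacelike or timelike -/
  ε : Fin s → ℝ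
  causal : ∀ α, (ε α = 1 ∧ ∀ p, 0 < g.val p (ξ α p) (ξ α p)) ∨
    (ε α = -1 ∧ ∀ p, g.val p (ξ α p) (ξ α p) < 0)
  compatible : ∀ p (x y : TangentSpace 𝓘(ℝ, E) p),
    g.val p (φ p x) (φ p y) = g.val p x y - ∑ α, ε α * η α p x * η α p y

variable {E M s}

/-- The vector field `X` is smooth near `p`. -/
def SmoothFieldAt (X : ∀ p : M, TangentSpace 𝓘(ℝ, E) p) (p : M) : Prop :=
  ContMDiffAt 𝓘(ℝ, E) (𝓘(ℝ, E).prod 𝓘(ℝ, E)) ∞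
    (fun q => Bundle.TotalSpace.mk' E (E := fun p : M => TangentSpace 𝓘(ℝ, E) p) q (X q)) p

/-- The exterior derivative of a 1-form `θ`, in the normalization
`dθ(X, Y) = (X(θ(Y)) - Y(θ(X)) - θ([X, Y])) / 2`. -/
def extDer (θ : ∀ p : M, TangentSpace 𝓘(ℝ, E) p →L[ℝ] ℝ)
    (X Y : ∀ p : M, TangentSpace 𝓘(ℝ, E) p) (p : M) : ℝ :=
  (mvfderiv 𝓘(ℝ, E) (fun q => θ q (Y q)) p (X p) - mvfderiv 𝓘(ℝ, E) (fun q => θ q (X q)) p (Y p)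
    - θ p (VectorField.mlieBracket 𝓘(ℝ, E) X Y p)) / 2

/-- The Nijenhuis torsion
`N_φ(X, Y) = [φX, φY] - φ[φX, Y] - φ[X, φY] + φ²[X, Y]` of a `(1,1)`-tensor field. -/
def nijenhuis (φ : ∀ p : M, TangentSpace 𝓘(ℝ, E) p →L[ℝ] TangentSpace 𝓘(ℝ, E) p)
    (X Y : ∀ p : M, TangentSpace 𝓘(ℝ, E) p) (p : M) : TangentSpace 𝓘(ℝ, E) p :=
  VectorField.mlieBracket 𝓘(ℝ, E) (fun q => φ q (X q)) (fun q => φ q (Y q)) p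
    - φ p (VectorField.mlieBracket 𝓘(ℝ, E) (fun q => φ q (X q)) Y p)
    - φ p (VectorField.mlieBracket 𝓘(ℝ, E) X (fun q => φ q (Y q)) p)
    + φ p (φ p (VectorField.mlieBracket 𝓘(ℝ, E) X Y p))

variable (E M s)

/-- An indefinite `S`-structure: an indefinite `g.f.f`-structure which is normal,
`N_φ + 2 dη^α ⊗ ξ_α = 0`, and satisfies `dη^α = Φ` for all `α`, where `Φ(X, Y) = g(X, φY)`. -/
structure IndefiniteSStructure extends IndefiniteGFFStructure E M s where
  normal : ∀ (p : M) (X Y : ∀ p : M, TangentSpace 𝓘(ℝ, E) p),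
    SmoothFieldAt X p → SmoothFieldAt Y p →
      nijenhuis φ X Y p + ∑ α, (2 * extDer (η α) X Y p) • ξ α p = 0
  extDer_η : ∀ (α : Fin s) (p : M) (X Y : ∀ p : M, TangentSpace 𝓘(ℝ, E) p),
    SmoothFieldAt X p → SmoothFieldAt Y p →
      extDer (η α) X Y p = g.val p (X p) (φ p (Y p))

variable {E M s}

namespace IndefiniteSStructure

variable (S : IndefiniteSStructure E M s)

/-- `M` is an `S`-space form of `φ`-sectional curvature `c`: for all `p` and all non-lightlike
`x ∈ Im φ_p`, the plane `span{x, φx}` has sectional curvature `c`. -/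
def IsSpaceForm (c : ℝ) : Prop :=
  ∀ (p : M), ∀ x ∈ (S.φ p).range, S.g.val p x x ≠ 0 → S.g.sectionalCurvature p x (S.φ p x) = c

/-- The `φ`-celestial sphere of `z ∈ T_p M`: the unit vectors of `z^⊥ ∩ Im φ_p`. -/
def phiCelestialSphere (p : M) (z : TangentSpace 𝓘(ℝ, E) p) : Set (TangentSpace 𝓘(ℝ, E) p) :=
  {x | x ∈ S.g.orth p z ∧ S.g.val p x x = 1 ∧ x ∈ (S.φ p).range}

/-- The `φ`-null congruence set `N_φ(z) = {z + x | x in the φ-celestial sphere of z}`. -/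
def phiNullCongruence (p : M) (z : TangentSpace 𝓘(ℝ, E) p) : Set (TangentSpace 𝓘(ℝ, E) p) :=
  {u | ∃ x ∈ S.phiCelestialSphere p z, u = z + x}

variable [FiniteDimensional ℝ E]

/-- `M` is `φ`-null Osserman with respect to `ξ_α`: at every point `p`, the characteristic polynomial
of `R̄_u` is independent of `u ∈ N_φ((ξ_α)_p)`. -/
def IsPhiNullOsserman (α : Fin s) : Prop :=
  ∀ p : M, ∀ u ∈ S.phiNullCongruence p (S.ξ α p), ∀ v ∈ S.phiNullCongruence p (S.ξ α p),
    (S.g.jacobiBar p u).charpoly = (S.g.jacobiBar p v).charpoly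

/-- The subspace `π(u^⊥ ∩ Im φ_p)` of `u^⊥ / span{u}`. -/
def orthImage (p : M) (u : TangentSpace 𝓘(ℝ, E) p) : Submodule ℝ (S.g.OrthQuotient p u) :=
  ((S.φ p).range.submoduleOf (S.g.orth p u)).map (Submodule.mkQ _)

/-- The set of eigenvalues of the restriction of `R̄_u` to (the image in `u^⊥ / span{u}` of)
`u^⊥ ∩ Im φ_p`. -/
def restrictedEigenvalues (p : M) (u : TangentSpace 𝓘(ℝ, E) p) : Set ℝ :=
  {μ | ∃ w ∈ S.orthImage p u, w ≠ 0 ∧ S.g.jacobiBar p u w = μ • w}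

/-- The restriction of `R̄_u` to `u^⊥ ∩ Im φ_p` has the single eigenvalue `μ`. -/
def HasSingleEigenvalue (p : M) (u : TangentSpace 𝓘(ℝ, E) p) (μ : ℝ) : Prop :=
  S.restrictedEigenvalues p u = {μ}

end IndefiniteSStructure

end Structures
end LorentzS

end

/-! The timelike field is indexed by `0` and the other one by `1`. Since the metric has index 1, the
complement of `ξ_0` is positive definite; hence `Im φ` is positive definite, `ε_0 = -1`, `ε_1 = 1`,
and `∑ ε_α = 0`.

Put `ξ̄ = ∑ ξ_α` and `η̄ = ∑ ε_α η^α`. As in contact metric geometry, normality together with `dη^α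
= Φ` determines the covariant derivatives: `∇_X ξ_α = -ε_α φX` and `(∇_X φ)Y = g(φX, φY) ξ̄ + η̄(Y)
φ²X` (`covξ_eq`, `covφ_eq`). A second differentiation gives `R(X, Y)ξ_α = ε_α (η̄(X) φ²Y - η̄(Y)
φ²X)` (`coordCurvature_ξ`). Because `∑ ε_α = 0`, both `ξ̄` and `η̄` are parallel, and therefore
`R(a, b)` commutes with `φ` when everything is in `Im φ` (`coordCurvature_φ`): on `Im φ` the
curvature has the symmetries of a Kähler curvature tensor.

For `u = ξ_0 + x` and `y ∈ Im φ` orthogonal to `x` one finds `R(y, u)u = y + R(y, x)x`. Both sides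
of the equivalence amount to `R(y, x)x = 0` for all such `x, y`. If `R̄_u` has the single eigenvalue
`λ`, the spectral theorem makes `R(·, x)x` equal to `λ - 1` on `x^⊥ ∩ Im φ`, so `Im φ` looks like a
space of constant curvature. This is incompatible with the Kähler symmetry in real dimension `2n ≥
4` unless the curvature vanishes (`jacobi_eq_zero_of_scalar`), which forces `λ = 1`. Conversely, a
Kähler type tensor with zero holomorphic sectional curvature vanishes
(`jacobi_eq_zero_of_sectional`); then `R̄_u` is the identity, since also `R(ξ_1, u)u = ξ_1 + u`. -/

noncomputable section

namespace LorentzS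

/-! ### Linear algebra of one tangent space: the structure determines `∇φ` and `∇η`. -/

section Pointwise

variable {E : Type*} [NormedAddCommGroup E] [NormedSpace ℝ E] {ι : Type*} [Fintype ι]
  [DecidableEq ι]

/-- The algebraic identities of an indefinite `g.f.f`-structure on one tangent space. -/
structure IsGFFAt (h : E →L[ℝ] E →L[ℝ] ℝ) (φ : E →L[ℝ] E) (ξ : ι → E) (η : ι → E →L[ℝ] ℝ)
    (ε : ι → ℝ) : Prop where
  symm : ∀ v w, h v w = h w v
  nondegenerate : ∀ v, (∀ w, h v w = 0) → v = 0
  φ_φ : ∀ x, φ (φ x) = -x + ∑ α, η α x • ξ α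
  φ_ξ : ∀ α, φ (ξ α) = 0
  η_ξ : ∀ α β, η α (ξ β) = if α = β then 1 else 0
  ε_mul_self : ∀ α, ε α * ε α = 1
  compatible : ∀ x y, h (φ x) (φ y) = h x y - ∑ α, ε α * η α x * η α y

namespace IsGFFAt

variable {h : E →L[ℝ] E →L[ℝ] ℝ} {φ : E →L[ℝ] E} {ξ : ι → E} {η : ι → E →L[ℝ] ℝ} {ε : ι → ℝ}

theorem eq_of_forall (H : IsGFFAt h φ ξ η ε) {v w : E} (hvw : ∀ z, h v z = h w z) : v = w := by
  rw [← sub_eq_zero]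
  refine H.nondegenerate _ fun z => ?_
  rw [map_sub, sub_apply, hvw, sub_self]

theorem η_φ (H : IsGFFAt h φ ξ η ε) (α : ι) (x : E) : η α (φ x) = 0 := by
  have h1 := H.φ_φ (φ x)
  rw [H.φ_φ x, map_add, map_neg, map_sum] at h1
  simp only [map_smul, H.φ_ξ, smul_zero, Finset.sum_const_zero, add_zero] at h1
  have h2 := congrArg (η α) (left_eq_add.1 h1)
  simpa [H.η_ξ] using h2

theorem metric_ξ_left (H : IsGFFAt h φ ξ η ε) (α : ι) (y : E) : h (ξ α) y = ε α * η α y := by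
  have := H.compatible (ξ α) y
  simp only [H.φ_ξ, H.η_ξ, map_zero, zero_apply] at this
  simpa using (sub_eq_zero.1 this.symm)

theorem metric_ξ_right (H : IsGFFAt h φ ξ η ε) (α : ι) (y : E) : h y (ξ α) = ε α * η α y := by
  rw [H.symm, H.metric_ξ_left]

theorem metric_φ_right (H : IsGFFAt h φ ξ η ε) (x y : E) : h x (φ y) = -h (φ x) y := by
  have := H.compatible x (φ y)
  simp only [H.φ_φ, H.η_φ, mul_zero, Finset.sum_const_zero, sub_zero, map_add, map_neg, map_sum,
    map_smul, H.metric_ξ_right, smul_zero, add_zero] at this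
  exact this.symm

theorem metric_φ_self (H : IsGFFAt h φ ξ η ε) (x : E) : h x (φ x) = 0 := by
  have h1 := H.metric_φ_right x x
  have h2 := H.symm x (φ x)
  linarith

theorem mem_range_iff (H : IsGFFAt h φ ξ η ε) {x : E} : x ∈ φ.range ↔ ∀ α, η α x = 0 := by
  constructor
  · rintro ⟨y, rfl⟩ α
    exact H.η_φ α y
  · intro hx
    refine ⟨-φ x, ?_⟩
    have := H.φ_φ x
    simp only [hx, zero_smul, Finset.sum_const_zero, add_zero] at this
    change φ (-φ x) = x
    rw [map_neg, this, neg_neg]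

theorem φ_φ_of_mem (H : IsGFFAt h φ ξ η ε) {x : E} (hx : x ∈ φ.range) : φ (φ x) = -x := by
  rw [H.φ_φ]
  simp [H.mem_range_iff.1 hx]

theorem decomposition (H : IsGFFAt h φ ξ η ε) (x : E) :
    x = φ (-φ x) + ∑ α, η α x • ξ α := by
  rw [map_neg, H.φ_φ]; abel

section Covariant

variable {A : E →L[ℝ] E →L[ℝ] E} {B : ι → E →L[ℝ] E →L[ℝ] ℝ} {C : ι → E →L[ℝ] E}

/-- The covariant derivative `A = ∇φ` of a normal structure with `dη^α = Φ`, in terms of the structure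
itself. Here `B^α = ∇η^α` and `C_α = ∇ξ_α`. -/
theorem metric_covariant_φ (H : IsGFFAt h φ ξ η ε)
    (hC : ∀ α X Y, h (C α X) Y = ε α * B α X Y)
    (hB : ∀ α X Y, B α X Y - B α Y X = 2 * h X (φ Y))
    (hskew : ∀ X Y Z, h (A X Y) Z = -h (A X Z) Y)
    (hcyc : ∀ X Y Z, h (A X Y) Z + h (A Y Z) X + h (A Z X) Y = 0)
    (hN : ∀ X Y, A (φ X) Y - A (φ Y) X + φ (A Y X) - φ (A X Y)
      + ∑ α, (2 * h X (φ Y)) • ξ α = 0)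
    (hφφ : ∀ X Y, A X (φ Y) + φ (A X Y) = ∑ α, (B α X Y • ξ α + η α Y • C α X))
    (hφξ : ∀ α X, A X (ξ α) + φ (C α X) = 0) (X Y Z : E) :
    h (A X Y) Z = ∑ α, ε α * (η α Z * h (φ Y) (φ X) - η α Y * h (φ Z) (φ X)) := by
  -- The `ξ_α` component of `∇φ`, from the derivative of `φ ξ_α = 0` and the skewness of `∇_X φ`.
  have hT : ∀ α X Y, h (A X Y) (ξ α) = -(ε α * B α X (φ Y)) := by
    intro α X Y
    have h1 : A X (ξ α) = -φ (C α X) := eq_neg_of_add_eq_zero_left (hφξ α X)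
    rw [hskew, h1, ← hC, map_neg, H.metric_φ_right, neg_apply]
  have hS : ∀ W P Q, h (A W (φ P)) Q - h (A W P) (φ Q) =
      ∑ α, (B α W P * (ε α * η α Q) + η α P * (ε α * B α W Q)) := by
    intro W P Q
    have h1 := congrArg (fun v => h v Q) (hφφ W P)
    simp only [map_add, map_sum, map_smul, add_apply, sum_apply, smul_apply, smul_eq_mul,
      H.metric_ξ_left, hC] at h1
    rw [← h1, H.metric_φ_right]
    ring
  have hNX : h (A (φ Y) Z) (φ X) - h (A (φ Z) Y) (φ X) + h (A Z Y) X - h (A Y Z) X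
      + ∑ α, ε α * (B α Z (φ Y) - B α Y (φ Z)) * η α X= 0 := by
    have h1 := congrArg (fun v => h v (φ X)) (hN Y Z)
    simp only [map_add, map_sub, map_sum, map_smul, add_apply, sub_apply, sum_apply,
      smul_apply, smul_eq_mul, H.metric_ξ_left, H.η_φ, mul_zero, Finset.sum_const_zero, add_zero,
      map_zero, zero_apply, H.compatible] at h1
    rw [← h1]
    have h2 : ∀ α Y Z, ε α * η α (A Y Z) = -(ε α * B α Y (φ Z)) := fun α Y Z => by
      rw [← H.metric_ξ_right, hT]
    simp only [h2, Finset.sum_neg_distrib, neg_mul, mul_sub, sub_mul, Finset.sum_sub_distrib]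
    ring
  -- The terms in which `∇φ` is paired with arguments `φY`, `φZ` cancel in the combination below.
  -- Two copies of `h (A X Y) Z` survive: one from `e4`, where `φ²Z` reproduces `-Z`, and one from
  -- the cyclic identity `e6`.
  have e1 := hS (φ Y) Z X
  have e2 := hS (φ Z) Y X
  have e3 := hcyc (φ Y) (φ Z) X
  have e4 := hS X Y (φ Z)
  rw [H.φ_φ Z, map_add, map_neg, map_sum] at e4
  simp only [map_smul, hT, smul_eq_mul, H.η_φ, mul_zero, zero_add] at e4
  have e5 := hskew (φ Z) (φ Y) X
  have e6 := hcyc X Y Z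
  have e7 := hskew Z Y X
  have e8 : h (A X Y) Z * 2 = ∑ α, (-(η α Z * (ε α * B α X (φ Y)))
      + η α Y * (ε α * B α X (φ Z))
      + (B α (φ Y) Z * (ε α * η α X) + η α Z * (ε α * B α (φ Y) X))
      - (B α (φ Z) Y * (ε α * η α X) + η α Y * (ε α * B α (φ Z) X))
      - ε α * (B α Z (φ Y) - B α Y (φ Z)) * η α X) := by
    simp only [Finset.sum_add_distrib, Finset.sum_sub_distrib, Finset.sum_neg_distrib,
      mul_neg] at e1 e2 e4 hNX ⊢
    linarith
  have e9 : h (A X Y) Z * 2 =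
      ∑ α, 2 * (ε α * (η α Z * h (φ Y) (φ X) - η α Y * h (φ Z) (φ X))) := by
    rw [e8]
    -- The forms `B^α` now occur only through their skew parts, which are multiples of `Φ`; the
    -- terms with `η^α(X)` cancel because `Φ(φY, Z) + Φ(Y, φZ) = 0`.
    refine Finset.sum_congr rfl fun α _ => ?_
    have b1 := hB α (φ Y) X
    have b2 := hB α (φ Z) X
    have b3 := hB α (φ Y) Z
    have b4 := hB α Y (φ Z)
    have b5 : h Y (φ (φ Z)) = -h (φ Y) (φ Z) := H.metric_φ_right Y (φ Z)
    rw [b5] at b4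
    linear_combination ε α * η α Z * b1 - ε α * η α Y * b2 + ε α * η α X * (b3 + b4)
  rw [← Finset.mul_sum] at e9
  linarith

theorem covariant_φ (H : IsGFFAt h φ ξ η ε)
    (hA : ∀ X Y Z,
      h (A X Y) Z = ∑ α, ε α * (η α Z * h (φ Y) (φ X) - η α Y * h (φ Z) (φ X))) (X Y : E) :
    A X Y = h (φ X) (φ Y) • ∑ α, ξ α + (∑ α, ε α * η α Y) • φ (φ X) := by
  refine H.eq_of_forall fun Z => ?_
  rw [hA, map_add, add_apply, map_smul, map_smul, smul_apply, smul_apply, map_sum, sum_apply,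
    H.symm (φ (φ X)) Z, H.metric_φ_right Z (φ X), smul_eq_mul, smul_eq_mul, Finset.mul_sum,
    Finset.sum_mul, ← Finset.sum_add_distrib]
  refine Finset.sum_congr rfl fun α _ => ?_
  rw [H.metric_ξ_left, H.symm (φ Y) (φ X)]
  ring

/-- The covariant derivatives of the forms `η^α`: `(∇_X η^α)(Y) = Φ(X, Y)`. -/
theorem covariant_η (H : IsGFFAt h φ ξ η ε)
    (hC : ∀ α X Y, h (C α X) Y = ε α * B α X Y)
    (hB : ∀ α X Y, B α X Y - B α Y X = 2 * h X (φ Y))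
    (hφξ : ∀ α X, A X (ξ α) + φ (C α X) = 0)
    (hξξ : ∀ α β X, h (C α X) (ξ β) + h (C β X) (ξ α) = 0)
    (hskew : ∀ X Y Z, h (A X Y) Z = -h (A X Z) Y)
    (hA : ∀ X Y Z,
      h (A X Y) Z = ∑ α, ε α * (η α Z * h (φ Y) (φ X) - η α Y * h (φ Z) (φ X)))
    (α : ι) (X Y : E) : B α X Y = h X (φ Y) := by
  have hne : ∀ α, ε α ≠ 0 := fun α h0 => by simpa [h0] using H.ε_mul_self α
  -- The formula for `∇φ`, read in the direction `ξ_α`.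
  have hφ : ∀ α X Y, B α X (φ Y) = -h (φ X) (φ Y) := by
    intro α X Y
    have h1 : A X (ξ α) = -φ (C α X) := eq_neg_of_add_eq_zero_left (hφξ α X)
    have h2 : h (A X Y) (ξ α) = -(ε α * B α X (φ Y)) := by
      rw [hskew, h1, ← hC, map_neg, H.metric_φ_right, neg_apply]
    have h3 := hA X Y (ξ α)
    simp only [H.η_ξ, H.φ_ξ, map_zero, zero_apply, mul_zero, sub_zero, ite_mul, one_mul,
      zero_mul, mul_ite, Finset.sum_ite_eq', Finset.mem_univ, if_true] at h3
    rw [h2, H.symm] at h3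
    apply mul_left_cancel₀ (hne α)
    linarith
  have hsymm : ∀ α X γ, B α X (ξ γ) = B α (ξ γ) X := by
    intro α X γ
    have := hB α X (ξ γ)
    rw [H.φ_ξ, map_zero] at this
    linarith
  -- The trilinear expression `ε_α B^α(ξ_γ, ξ_β)` is skew in `α, β` and symmetric in `γ, β`;
  -- alternating the two symmetries three times shows that it equals its negative.
  have hξ : ∀ α β γ, B α (ξ γ) (ξ β) = 0 := by
    have k : ∀ α β γ, ε α * B α (ξ γ) (ξ β) = -(ε β * B β (ξ γ) (ξ α)) := fun α β γ => by
      rw [← hC, ← hC]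
      exact eq_neg_of_add_eq_zero_left (hξξ α β _)
    intro α β γ
    apply mul_left_cancel₀ (hne α)
    have k1 := k α β γ
    have k2 := k β γ α
    have k3 := k γ α β
    rw [hsymm β (ξ γ) α] at k1
    rw [hsymm γ (ξ α) β] at k2
    rw [hsymm α (ξ β) γ] at k3
    linarith
  have hξ' : ∀ γ, B α X (ξ γ) = 0 := by
    intro γ
    rw [H.decomposition X, map_add, map_sum, add_apply, sum_apply, hsymm α (φ _), hφ, H.φ_ξ]
    simp [hξ]
  conv_lhs => rw [H.decomposition Y]
  rw [map_add, map_sum, hφ]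
  simp only [map_smul, hξ', smul_zero, Finset.sum_const_zero, add_zero, map_neg, neg_neg]
  simp [H.compatible, H.η_φ]

end Covariant
end IsGFFAt
end Pointwise

/-! ### The Levi-Civita connection and its curvature in coordinates. -/

section CoordinateConnection

variable {E : Type*} [NormedAddCommGroup E] [NormedSpace ℝ E]

/-- The device by which a pointwise identity, valid on a neighbourhood, is differentiated: the
derivatives of the two sides are computed separately and compared. -/
theorem hasFDerivAt_eq_of_eqOn {F : Type*} [NormedAddCommGroup F] [NormedSpace ℝ F] {U : Set E}
    {y : E} (hU : U ∈ 𝓝 y) {f g : E → F} {f' g' : E →L[ℝ] F} (hfg : ∀ z ∈ U, f z = g z)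
    (hf : HasFDerivAt f f' y) (hg : HasFDerivAt g g' y) : f' = g' :=
  hf.unique (hg.congr_of_eventuallyEq (Filter.mem_of_superset hU hfg))

/-- The metric `h` is smooth, symmetric and non-degenerate on the open set `U`. -/
structure IsCoordMetric (U : Set E) (h : E → E →L[ℝ] E →L[ℝ] ℝ) : Prop where
  isOpen : IsOpen U
  contDiffOn : ContDiffOn ℝ ∞ h U
  symm : ∀ y ∈ U, ∀ v w, h y v w = h y w v
  isInvertible : ∀ y ∈ U, (h y).IsInvertible

namespace IsCoordMetric

variable {U : Set E} {h : E → E →L[ℝ] E →L[ℝ] ℝ} {y : E}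

theorem contDiffAt (H : IsCoordMetric U h) (hy : y ∈ U) : ContDiffAt ℝ ∞ h y :=
  H.contDiffOn.contDiffAt (H.isOpen.mem_nhds hy)

theorem hasFDerivAt (H : IsCoordMetric U h) (hy : y ∈ U) : HasFDerivAt h (fderiv ℝ h y) y :=
  ((H.contDiffAt hy).differentiableAt (by simp)).hasFDerivAt

theorem fderiv_symm (H : IsCoordMetric U h) (hy : y ∈ U) (a v w : E) :
    fderiv ℝ h y a v w = fderiv ℝ h y a w v := by
  have hd := H.hasFDerivAt hy
  have := hasFDerivAt_eq_of_eqOn (H.isOpen.mem_nhds hy) (fun z hz => H.symm z hz v w)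
    ((hd.clm_apply (hasFDerivAt_const v y)).clm_apply (hasFDerivAt_const w y))
    ((hd.clm_apply (hasFDerivAt_const w y)).clm_apply (hasFDerivAt_const v y))
  simpa using congrArg (fun L : E →L[ℝ] ℝ => L a) this

theorem metric_christoffel (H : IsCoordMetric U h) (hy : y ∈ U) (v w z : E) :
    h y (christoffel h y v w) z =
      2⁻¹ * (fderiv ℝ h y v w z + fderiv ℝ h y w v z - fderiv ℝ h y z v w) := by
  rw [christoffel_apply, map_smul, (H.isInvertible y hy).self_apply_inverse]
  simp [christoffelFirst_apply]

theorem christoffel_symm (H : IsCoordMetric U h) (hy : y ∈ U) (v w : E) :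
    christoffel h y v w = christoffel h y w v := by
  rw [christoffel_apply, christoffel_apply]
  congr 2
  ext z
  rw [christoffelFirst_apply, christoffelFirst_apply, H.fderiv_symm hy z v w]
  ring

/-- The Levi-Civita connection is metric. -/
theorem fderiv_metric (H : IsCoordMetric U h) (hy : y ∈ U) (a v w : E) :
    fderiv ℝ h y a v w = h y (christoffel h y a v) w + h y v (christoffel h y a w) := by
  rw [H.symm y hy v, H.metric_christoffel hy, H.metric_christoffel hy, H.fderiv_symm hy v a w,
    H.fderiv_symm hy w a v, H.fderiv_symm hy a w v]
  ring

theorem differentiableAt_christoffel [CompleteSpace E] (H : IsCoordMetric U h) (hy : y ∈ U) :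
    DifferentiableAt ℝ (christoffel h) y := by
  have h1 : DifferentiableAt ℝ (fderiv ℝ h) y :=
    ((H.contDiffAt hy).fderiv_right (m := ∞) (by simp)).differentiableAt (by simp)
  have h2 : DifferentiableAt ℝ (fun q => (h q).inverse) y :=
    (((H.isInvertible y hy).contDiffAt_map_inverse (n := 1)).differentiableAt (by norm_num)).comp y
      (H.hasFDerivAt hy).differentiableAt
  have hf : DifferentiableAt ℝ (fun q => (fderiv ℝ h q).flip) y :=
    ((ContinuousLinearMap.flipₗᵢ ℝ E E
      (E →L[ℝ] ℝ)).toContinuousLinearEquiv.differentiableAt).comp y h1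
  have h3 : DifferentiableAt ℝ (christoffelFirst h) y :=
    (h1.add hf).sub ((differentiableAt_const _).clm_comp hf)
  have h4 : DifferentiableAt ℝ
      (fun q => ContinuousLinearMap.compL ℝ E (E →L[ℝ] ℝ) E (h q).inverse) y :=
    (ContinuousLinearMap.compL ℝ E (E →L[ℝ] ℝ) E).differentiableAt.comp y h2
  exact (h4.clm_comp h3).fun_const_smul _

theorem fderiv_christoffel_symm [CompleteSpace E] (H : IsCoordMetric U h) (hy : y ∈ U)
    (a v w : E) :
    fderiv ℝ (christoffel h) y a v w = fderiv ℝ (christoffel h) y a w v := by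
  have hd := (H.differentiableAt_christoffel hy).hasFDerivAt
  have := hasFDerivAt_eq_of_eqOn (H.isOpen.mem_nhds hy) (fun z hz => H.christoffel_symm hz v w)
    ((hd.clm_apply (hasFDerivAt_const v y)).clm_apply (hasFDerivAt_const w y))
    ((hd.clm_apply (hasFDerivAt_const w y)).clm_apply (hasFDerivAt_const v y))
  simpa using congrArg (fun L : E →L[ℝ] E => L a) this

/-- The derivatives of the Christoffel symbols and their products both cancel in pairs because the
connection is torsion-free. -/
theorem coordCurvature_bianchi [CompleteSpace E] (H : IsCoordMetric U h) (hy : y ∈ U)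
    (a b c : E) :
    coordCurvature h y a b c + coordCurvature h y b c a + coordCurvature h y c a b = 0 := by
  simp only [coordCurvature]
  rw [H.fderiv_christoffel_symm hy a b c, H.fderiv_christoffel_symm hy b c a,
    H.fderiv_christoffel_symm hy c a b, H.christoffel_symm hy b c, H.christoffel_symm hy a c,
    H.christoffel_symm hy b a]
  abel

theorem coordCurvature_metric_self [CompleteSpace E] (H : IsCoordMetric U h) (hy : y ∈ U)
    (a b u : E) : h y (coordCurvature h y a b u) u = 0 :=
  coordCurvature_skew ((H.contDiffAt hy).of_le (WithTop.coe_le_coe.2 (le_top : (2 : ℕ∞) ≤ ⊤)))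
    (Filter.mem_of_superset (H.isOpen.mem_nhds hy) H.symm)
    (Filter.mem_of_superset (H.isOpen.mem_nhds hy) H.isInvertible) a b u

end IsCoordMetric

theorem coordCurvature_swap (h : E → E →L[ℝ] E →L[ℝ] ℝ) (y a b c : E) :
    coordCurvature h y a b c = -coordCurvature h y b a c := by
  simp only [coordCurvature]; abel

theorem coordCurvature_add_right (h : E → E →L[ℝ] E →L[ℝ] ℝ) (y a b c c' : E) :
    coordCurvature h y a b (c + c') = coordCurvature h y a b c + coordCurvature h y a b c' := by
  simp only [coordCurvature, map_add]; abel

theorem coordCurvature_smul_right (h : E → E →L[ℝ] E →L[ℝ] ℝ) (y : E) (r : ℝ) (a b c : E) :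
    coordCurvature h y a b (r • c) = r • coordCurvature h y a b c := by
  simp only [coordCurvature, map_smul, smul_add, smul_sub]

end CoordinateConnection

/-! ### An `S`-structure in coordinates and the derivatives of its defining identities. -/

section CoordinateStructure

variable {E : Type*} [NormedAddCommGroup E] [NormedSpace ℝ E] {ι : Type*} [Fintype ι]
  [DecidableEq ι]

/-- An indefinite `S`-structure on an open subset `U` of the vector space `E`; the conditions on `dη` and on
the Nijenhuis torsion are written out on constant vector fields. -/
structure IsCoordS (U : Set E) (h : E → E →L[ℝ] E →L[ℝ] ℝ) (φ : E → E →L[ℝ] E) (ξ : ι → E → E)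
    (η : ι → E → E →L[ℝ] ℝ) (ε : ι → ℝ) : Prop where
  metric : IsCoordMetric U h
  φ_contDiffOn : ContDiffOn ℝ ∞ φ U
  ξ_contDiffOn : ∀ α, ContDiffOn ℝ ∞ (ξ α) U
  η_contDiffOn : ∀ α, ContDiffOn ℝ ∞ (η α) U
  gff : ∀ y ∈ U, IsGFFAt (h y) (φ y) (fun α => ξ α y) (fun α => η α y) ε
  extDer : ∀ α, ∀ y ∈ U, ∀ v w,
    fderiv ℝ (η α) y v w - fderiv ℝ (η α) y w v = 2 * h y v (φ y w)
  normal : ∀ y ∈ U, ∀ v w, fderiv ℝ φ y (φ y v) w - fderiv ℝ φ y (φ y w) v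
    + φ y (fderiv ℝ φ y w v) - φ y (fderiv ℝ φ y v w) + ∑ α, (2 * h y v (φ y w)) • ξ α y = 0

namespace IsCoordS

variable {U : Set E} {h : E → E →L[ℝ] E →L[ℝ] ℝ} {φ : E → E →L[ℝ] E} {ξ : ι → E → E}
  {η : ι → E → E →L[ℝ] ℝ} {ε : ι → ℝ} {y : E}

theorem mem_nhds (H : IsCoordS U h φ ξ η ε) (hy : y ∈ U) : U ∈ 𝓝 y :=
  H.metric.isOpen.mem_nhds hy

theorem hasFDerivAt_φ (H : IsCoordS U h φ ξ η ε) (hy : y ∈ U) :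
    HasFDerivAt φ (fderiv ℝ φ y) y :=
  ((H.φ_contDiffOn.contDiffAt (H.mem_nhds hy)).differentiableAt (by simp)).hasFDerivAt

theorem hasFDerivAt_ξ (H : IsCoordS U h φ ξ η ε) (hy : y ∈ U) (α : ι) :
    HasFDerivAt (ξ α) (fderiv ℝ (ξ α) y) y :=
  (((H.ξ_contDiffOn α).contDiffAt (H.mem_nhds hy)).differentiableAt (by simp)).hasFDerivAt

theorem hasFDerivAt_η (H : IsCoordS U h φ ξ η ε) (hy : y ∈ U) (α : ι) :
    HasFDerivAt (η α) (fderiv ℝ (η α) y) y :=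
  (((H.η_contDiffOn α).contDiffAt (H.mem_nhds hy)).differentiableAt (by simp)).hasFDerivAt

theorem hasFDerivAt_fderiv {F : Type*} [NormedAddCommGroup F] [NormedSpace ℝ F] {f : E → F}
    (hf : ContDiffOn ℝ ∞ f U) (hU : U ∈ 𝓝 y) :
    HasFDerivAt (fderiv ℝ f) (fderiv ℝ (fderiv ℝ f) y) y :=
  (((hf.contDiffAt hU).fderiv_right (m := ∞) (by simp)).differentiableAt (by simp)).hasFDerivAt

theorem fderiv_fderiv_symm {F : Type*} [NormedAddCommGroup F] [NormedSpace ℝ F] {f : E → F}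
    (hf : ContDiffOn ℝ ∞ f U) (hU : U ∈ 𝓝 y) (a b : E) :
    fderiv ℝ (fderiv ℝ f) y a b = fderiv ℝ (fderiv ℝ f) y b a :=
  ((hf.contDiffAt hU).isSymmSndFDerivAt (by
    simpa using WithTop.coe_le_coe.2 (le_top : (2 : ℕ∞) ≤ ⊤))).eq a b

/-- The covariant derivative `∇φ` in coordinates. -/
def covφ (h : E → E →L[ℝ] E →L[ℝ] ℝ) (φ : E → E →L[ℝ] E) (y : E) : E →L[ℝ] E →L[ℝ] E :=
  fderiv ℝ φ y + (ContinuousLinearMap.compL ℝ E E E).flip (φ y) ∘L christoffel h y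
    - ContinuousLinearMap.compL ℝ E E E (φ y) ∘L christoffel h y

theorem covφ_apply (h : E → E →L[ℝ] E →L[ℝ] ℝ) (φ : E → E →L[ℝ] E) (y v w : E) :
    covφ h φ y v w = fderiv ℝ φ y v w + christoffel h y v (φ y w) - φ y (christoffel h y v w) := by
  simp [covφ]

/-- The covariant derivative `∇η` of a 1-form in coordinates. -/
def covη (h : E → E →L[ℝ] E →L[ℝ] ℝ) (η : E → E →L[ℝ] ℝ) (y : E) : E →L[ℝ] E →L[ℝ] ℝ :=
  fderiv ℝ η y - ContinuousLinearMap.compL ℝ E E ℝ (η y) ∘L christoffel h y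

theorem covη_apply (h : E → E →L[ℝ] E →L[ℝ] ℝ) (η : E → E →L[ℝ] ℝ) (y v w : E) :
    covη h η y v w = fderiv ℝ η y v w - η y (christoffel h y v w) := by
  simp [covη]

/-- The covariant derivative `∇ξ` of a vector field in coordinates. -/
def covξ (h : E → E →L[ℝ] E →L[ℝ] ℝ) (ξ : E → E) (y : E) : E →L[ℝ] E :=
  fderiv ℝ ξ y + (christoffel h y).flip (ξ y)

theorem covξ_apply (h : E → E →L[ℝ] E →L[ℝ] ℝ) (ξ : E → E) (y v : E) :
    covξ h ξ y v = fderiv ℝ ξ y v + christoffel h y v (ξ y) := by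
  simp [covξ]

/-- The derivative of `g(ξ_α, ·) = ε_α η^α`, as the connection is metric. -/
theorem metric_covξ (H : IsCoordS U h φ ξ η ε) (hy : y ∈ U) (α : ι) (v w : E) :
    h y (covξ h (ξ α) y v) w = ε α * covη h (η α) y v w := by
  have e := hasFDerivAt_eq_of_eqOn (H.mem_nhds hy) (fun z hz => (H.gff z hz).metric_ξ_left α w)
    (((H.metric.hasFDerivAt hy).clm_apply (H.hasFDerivAt_ξ hy α)).clm_apply (hasFDerivAt_const w y))
    (((H.hasFDerivAt_η hy α).clm_apply (hasFDerivAt_const w y)).const_mul (ε α))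
  have e := congrArg (fun L : E →L[ℝ] ℝ => L v) e
  simp [H.metric.fderiv_metric hy] at e
  have e2 := (H.gff y hy).metric_ξ_left α (christoffel h y v w)
  rw [covξ_apply, covη_apply, map_add, add_apply]
  linarith

theorem covη_skew (H : IsCoordS U h φ ξ η ε) (hy : y ∈ U) (α : ι) (v w : E) :
    covη h (η α) y v w - covη h (η α) y w v = 2 * h y v (φ y w) := by
  rw [covη_apply, covη_apply, ← H.extDer α y hy, H.metric.christoffel_symm hy v w]
  ring

theorem metric_covφ (H : IsCoordS U h φ ξ η ε) (hy : y ∈ U) (a v w : E) :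
    h y (covφ h φ y a v) w = fderiv ℝ h y a (φ y v) w + h y (fderiv ℝ φ y a v) w
      - h y (φ y v) (christoffel h y a w) - h y (φ y (christoffel h y a v)) w := by
  rw [covφ_apply, H.metric.fderiv_metric hy]
  simp
  ring

theorem covφ_skew (H : IsCoordS U h φ ξ η ε) (hy : y ∈ U) (a v w : E) :
    h y (covφ h φ y a v) w = -h y (covφ h φ y a w) v := by
  have k : ∀ z ∈ U, ∀ v w, h z (φ z v) w = -h z (φ z w) v := fun z hz v w => by
    rw [(H.gff z hz).symm (φ z w) v, (H.gff z hz).metric_φ_right, neg_neg]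
  have d : ∀ v w, HasFDerivAt (fun z => h z (φ z v) w) _ y := fun v w =>
    ((H.metric.hasFDerivAt hy).clm_apply ((H.hasFDerivAt_φ hy).clm_apply
      (hasFDerivAt_const v y))).clm_apply (hasFDerivAt_const w y)
  have e := hasFDerivAt_eq_of_eqOn (H.mem_nhds hy) (fun z hz => k z hz v w) (d v w) (d w v).neg
  have e := congrArg (fun L : E →L[ℝ] ℝ => L a) e
  simp at e
  rw [H.metric_covφ hy, H.metric_covφ hy, k y hy v, k y hy w]
  linarith

theorem covφ_cyclic [Nonempty ι] (H : IsCoordS U h φ ξ η ε) (hy : y ∈ U) (a b c : E) :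
    h y (covφ h φ y a b) c + h y (covφ h φ y b c) a + h y (covφ h φ y c a) b = 0 := by
  obtain ⟨α⟩ := ‹Nonempty ι›
  have k : ∀ v w, h y (φ y v) w = -h y (φ y w) v := fun v w => by
    rw [(H.gff y hy).symm (φ y w) v, (H.gff y hy).metric_φ_right, neg_neg]
  -- The cyclic sum is `dΦ`, and `Φ = dη^α` for any one index `α`. So the derivative of `Φ` is a
  -- difference of second derivatives of `η^α`, whose cyclic sum vanishes by their symmetry; the
  -- Christoffel terms cancel likewise.
  have key : ∀ a v w, fderiv ℝ h y a (φ y v) w + h y (fderiv ℝ φ y a v) w =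
      2⁻¹ * (fderiv ℝ (fderiv ℝ (η α)) y a w v - fderiv ℝ (fderiv ℝ (η α)) y a v w) := by
    intro a v w
    have d := hasFDerivAt_fderiv (H.η_contDiffOn α) (H.mem_nhds hy)
    have e := hasFDerivAt_eq_of_eqOn (H.mem_nhds hy)
      (g := fun z => 2⁻¹ * (fderiv ℝ (η α) z w v - fderiv ℝ (η α) z v w))
      (fun z hz => by rw [H.extDer α z hz, (H.gff z hz).symm w]; ring)
      (((H.metric.hasFDerivAt hy).clm_apply ((H.hasFDerivAt_φ hy).clm_apply
        (hasFDerivAt_const v y))).clm_apply (hasFDerivAt_const w y))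
      ((((d.clm_apply (hasFDerivAt_const w y)).clm_apply (hasFDerivAt_const v y)).sub
        ((d.clm_apply (hasFDerivAt_const v y)).clm_apply (hasFDerivAt_const w y))).const_mul 2⁻¹)
    have e := congrArg (fun L : E →L[ℝ] ℝ => L a) e
    simpa [add_comm] using e
  have s := fun a b => fderiv_fderiv_symm (H.η_contDiffOn α) (H.mem_nhds hy) a b
  rw [H.metric_covφ hy, H.metric_covφ hy, H.metric_covφ hy, key, key, key, s a b, s b c, s c a,
    H.metric.christoffel_symm hy a b, H.metric.christoffel_symm hy b c,
    H.metric.christoffel_symm hy c a, k b, k c, k a]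
  ring

/-- For a torsion-free connection the partial derivatives in the Nijenhuis torsion may be replaced
by covariant ones: all Christoffel terms cancel. -/
theorem covφ_normal (H : IsCoordS U h φ ξ η ε) (hy : y ∈ U) (v w : E) :
    covφ h φ y (φ y v) w - covφ h φ y (φ y w) v + φ y (covφ h φ y w v) - φ y (covφ h φ y v w)
      + ∑ α, (2 * h y v (φ y w)) • ξ α y = 0 := by
  rw [← H.normal y hy v w]
  simp only [covφ_apply, map_add, map_sub]
  rw [H.metric.christoffel_symm hy w v, H.metric.christoffel_symm hy (φ y v) (φ y w),
    H.metric.christoffel_symm hy w (φ y v), H.metric.christoffel_symm hy v (φ y w)]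
  abel

/-- The covariant derivative of `φ² = -I + ∑ η^α ⊗ ξ_α`. -/
theorem covφ_φ (H : IsCoordS U h φ ξ η ε) (hy : y ∈ U) (a w : E) :
    covφ h φ y a (φ y w) + φ y (covφ h φ y a w) =
      ∑ α, (covη h (η α) y a w • ξ α y + η α y w • covξ h (ξ α) y a) := by
  have d := (H.hasFDerivAt_φ hy).clm_apply ((H.hasFDerivAt_φ hy).clm_apply (hasFDerivAt_const w y))
  have e := hasFDerivAt_eq_of_eqOn (H.mem_nhds hy) (fun z hz => (H.gff z hz).φ_φ w) d
    ((HasFDerivAt.fun_sum fun α (_ : α ∈ Finset.univ) =>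
      ((H.hasFDerivAt_η hy α).clm_apply (hasFDerivAt_const w y)).smul
        (H.hasFDerivAt_ξ hy α)).const_add (-w))
  have e := congrArg (fun L : E →L[ℝ] E => L a) e
  simp [sum_apply] at e
  have g := (H.gff y hy).φ_φ
  simp only [covφ_apply, covη_apply, covξ_apply, map_add, map_sub, g w, g (christoffel h y a w),
    map_neg, map_sum, map_smul, sub_smul, smul_add, Finset.sum_add_distrib,
    Finset.sum_sub_distrib] at e ⊢
  linear_combination (norm := module) e

theorem covφ_ξ (H : IsCoordS U h φ ξ η ε) (hy : y ∈ U) (α : ι) (a : E) :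
    covφ h φ y a (ξ α y) + φ y (covξ h (ξ α) y a) = 0 := by
  have e := hasFDerivAt_eq_of_eqOn (H.mem_nhds hy) (fun z hz => (H.gff z hz).φ_ξ α)
    ((H.hasFDerivAt_φ hy).clm_apply (H.hasFDerivAt_ξ hy α)) (hasFDerivAt_const 0 y)
  have e := congrArg (fun L : E →L[ℝ] E => L a) e
  simp at e
  rw [covφ_apply, covξ_apply, (H.gff y hy).φ_ξ, map_zero, map_add]
  linear_combination (norm := module) e

/-- The functions `g(ξ_α, ξ_β)` are constant. -/
theorem covξ_ξ (H : IsCoordS U h φ ξ η ε) (hy : y ∈ U) (α β : ι) (a : E) :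
    h y (covξ h (ξ α) y a) (ξ β y) + h y (covξ h (ξ β) y a) (ξ α y) = 0 := by
  have e := hasFDerivAt_eq_of_eqOn (H.mem_nhds hy)
    (fun z hz => ((H.gff z hz).metric_ξ_left α (ξ β z)).trans
      (congrArg (ε α * ·) ((H.gff z hz).η_ξ α β)))
    (((H.metric.hasFDerivAt hy).clm_apply (H.hasFDerivAt_ξ hy α)).clm_apply
      (H.hasFDerivAt_ξ hy β)) (hasFDerivAt_const _ y)
  have e := congrArg (fun L : E →L[ℝ] ℝ => L a) e
  simp [H.metric.fderiv_metric hy] at e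
  have s := (H.gff y hy).symm (ξ α y)
  rw [s, s] at e
  rw [covξ_apply, covξ_apply, map_add, map_add, add_apply, add_apply]
  linarith

end IsCoordS
end CoordinateStructure

/-! ### Formulas for `∇φ`, `∇ξ`, and the curvature identities they imply. -/

section CoordinateCurvature

variable {E : Type*} [NormedAddCommGroup E] [NormedSpace ℝ E] {ι : Type*} [Fintype ι]
  [DecidableEq ι] [Nonempty ι]

namespace IsCoordS

variable {U : Set E} {h : E → E →L[ℝ] E →L[ℝ] ℝ} {φ : E → E →L[ℝ] E} {ξ : ι → E → E}
  {η : ι → E → E →L[ℝ] ℝ} {ε : ι → ℝ} {y : E}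

theorem metric_covφ_eq (H : IsCoordS U h φ ξ η ε) (hy : y ∈ U) (a b c : E) :
    h y (covφ h φ y a b) c =
      ∑ α, ε α * (η α y c * h y (φ y b) (φ y a) - η α y b * h y (φ y c) (φ y a)) :=
  (H.gff y hy).metric_covariant_φ (A := covφ h φ y) (B := fun α => covη h (η α) y)
    (C := fun α => covξ h (ξ α) y) (H.metric_covξ hy) (H.covη_skew hy) (H.covφ_skew hy)
    (H.covφ_cyclic hy) (H.covφ_normal hy) (H.covφ_φ hy) (H.covφ_ξ hy) a b c

/-- `(∇_X φ)Y = g(φX, φY) ξ̄ + η̄(Y) φ²X` with `ξ̄ = ∑ ξ_α` and `η̄ = ∑ ε_α η^α`. -/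
theorem covφ_eq (H : IsCoordS U h φ ξ η ε) (hy : y ∈ U) (a b : E) :
    covφ h φ y a b = h y (φ y a) (φ y b) • ∑ α, ξ α y + (∑ α, ε α * η α y b) • φ y (φ y a) :=
  (H.gff y hy).covariant_φ (H.metric_covφ_eq hy) a b

/-- `(∇_X η^α)(Y) = g(X, φY)`. -/
theorem covη_eq (H : IsCoordS U h φ ξ η ε) (hy : y ∈ U) (α : ι) (a b : E) :
    covη h (η α) y a b = h y a (φ y b) :=
  (H.gff y hy).covariant_η (A := covφ h φ y) (B := fun α => covη h (η α) y)
    (C := fun α => covξ h (ξ α) y) (H.metric_covξ hy) (H.covη_skew hy) (H.covφ_ξ hy)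
    (H.covξ_ξ hy) (H.covφ_skew hy) (H.metric_covφ_eq hy) α a b

/-- `∇_X ξ_α = -ε_α φX`. -/
theorem covξ_eq (H : IsCoordS U h φ ξ η ε) (hy : y ∈ U) (α : ι) (a : E) :
    covξ h (ξ α) y a = -(ε α • φ y a) := by
  refine (H.gff y hy).eq_of_forall fun z => ?_
  rw [H.metric_covξ hy, H.covη_eq hy, (H.gff y hy).metric_φ_right, map_neg, map_smul, neg_apply,
    smul_apply, smul_eq_mul, mul_neg]

variable [CompleteSpace E]

/-- `R(X, Y)ξ_α = -ε_α ((∇_X φ)Y - (∇_Y φ)X)`. -/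
theorem coordCurvature_ξ_covφ (H : IsCoordS U h φ ξ η ε) (hy : y ∈ U) (α : ι) (a b : E) :
    coordCurvature h y a b (ξ α y) = -(ε α • (covφ h φ y a b - covφ h φ y b a)) := by
  -- The equation `∇ξ_α = -ε_α φ` solved for the partial derivatives. Differentiating once more and
  -- using the symmetry of the second derivative of `ξ_α` yields the Ricci identity for `ξ_α`.
  have hξ : ∀ z ∈ U, ∀ b, fderiv ℝ (ξ α) z b = -(ε α • φ z b) - christoffel h z b (ξ α z) :=
    fun z hz b => by rw [← H.covξ_eq hz, covξ_apply, add_sub_cancel_right]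
  have hΓ := (H.metric.differentiableAt_christoffel hy).hasFDerivAt
  have key : ∀ a b, fderiv ℝ (fderiv ℝ (ξ α)) y a b = -(ε α • fderiv ℝ φ y a b)
      - (fderiv ℝ (christoffel h) y a b (ξ α y)
        + christoffel h y b (-(ε α • φ y a) - christoffel h y a (ξ α y))) := by
    intro a b
    have e := hasFDerivAt_eq_of_eqOn (H.mem_nhds hy) (fun z hz => hξ z hz b)
      ((hasFDerivAt_fderiv (H.ξ_contDiffOn α) (H.mem_nhds hy)).clm_apply (hasFDerivAt_const b y))
      ((((H.hasFDerivAt_φ hy).clm_apply (hasFDerivAt_const b y)).const_smul (ε α)).neg.sub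
        ((hΓ.clm_apply (hasFDerivAt_const b y)).clm_apply (H.hasFDerivAt_ξ hy α)))
    have e := congrArg (fun L : E →L[ℝ] E => L a) e
    simp [hξ y hy] at e
    rw [e]
    simp only [map_sub, map_neg, map_smul]
    abel
  have s := fderiv_fderiv_symm (H.ξ_contDiffOn α) (H.mem_nhds hy) a b
  rw [key a b, key b a] at s
  simp only [coordCurvature, covφ_apply, map_sub, map_neg, map_smul,
    H.metric.christoffel_symm hy b a] at s ⊢
  linear_combination (norm := module) -s

/-- `R(X, Y)ξ_α = ε_α (η̄(X) φ²Y - η̄(Y) φ²X)`. -/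
theorem coordCurvature_ξ (H : IsCoordS U h φ ξ η ε) (hy : y ∈ U) (α : ι) (a b : E) :
    coordCurvature h y a b (ξ α y) = ε α • ((∑ β, ε β * η β y a) • φ y (φ y b)
      - (∑ β, ε β * η β y b) • φ y (φ y a)) := by
  rw [H.coordCurvature_ξ_covφ hy, H.covφ_eq hy, H.covφ_eq hy, (H.gff y hy).symm (φ y a)]
  module

/-- If `∑ ε_α = 0` then `φ` commutes with the curvature operators on the image of `φ`. -/
theorem coordCurvature_φ (H : IsCoordS U h φ ξ η ε) (hε : ∑ α, ε α = 0) (hy : y ∈ U) {a b c : E}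
    (ha : a ∈ (φ y).range) (hb : b ∈ (φ y).range) (hc : c ∈ (φ y).range) :
    coordCurvature h y a b (φ y c) = φ y (coordCurvature h y a b c) := by
  -- The formula for `∇φ` solved for the partial derivatives, with `g(φb, φc)` and `φ²b` expanded,
  -- so that `φ` enters only through the Christoffel terms.
  have hφ : ∀ z ∈ U, ∀ b c, fderiv ℝ φ z b c =
      ((h z b c - ∑ α, ε α * η α z b * η α z c) • ∑ α, ξ α z
        + (∑ α, ε α * η α z c) • (-b + ∑ α, η α z b • ξ α z))
      - christoffel h z b (φ z c) + φ z (christoffel h z b c) := by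
    intro z hz b c
    rw [← (H.gff z hz).compatible, ← (H.gff z hz).φ_φ, ← H.covφ_eq hz, covφ_apply]
    abel
  have hΓ := (H.metric.differentiableAt_christoffel hy).hasFDerivAt
  -- Here and in `hcovη`: `∇ξ̄ = -(∑ ε_α) φ = 0` and `∇η̄ = (∑ ε_α) Φ = 0`.
  have hcov : ∀ a, ∑ α, (fderiv ℝ (ξ α) y a + christoffel h y a (ξ α y)) = 0 := by
    intro a
    simp_rw [← covξ_apply, H.covξ_eq hy, Finset.sum_neg_distrib, ← Finset.sum_smul, hε, zero_smul,
      neg_zero]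
  have hcovη : ∀ a c, ∑ α, ε α * (fderiv ℝ (η α) y a c - η α y (christoffel h y a c)) = 0 := by
    intro a c
    simp_rw [← covη_apply, H.covη_eq hy, ← Finset.sum_mul, hε, zero_mul]
  -- The constant fields `b, c` are annihilated by the `η^α` only at `y`. Products of two such
  -- factors have zero derivative there, but a single factor `η̄(c)` leaves the term with `b`.
  have key : ∀ a b, b ∈ (φ y).range → fderiv ℝ (fderiv ℝ φ) y a b c =
      (fderiv ℝ h y a b c • ∑ α, ξ α y + h y b c • ∑ α, fderiv ℝ (ξ α) y a
        - (∑ α, ε α * fderiv ℝ (η α) y a c) • b)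
      - (fderiv ℝ (christoffel h) y a b (φ y c) + christoffel h y b (fderiv ℝ φ y a c))
      + (fderiv ℝ φ y a (christoffel h y b c) + φ y (fderiv ℝ (christoffel h) y a b c)) := by
    intro a b hb
    have hb := (H.gff y hy).mem_range_iff.1 hb
    have hc := (H.gff y hy).mem_range_iff.1 hc
    have dη : ∀ α v, HasFDerivAt (fun z => η α z v) _ y :=
      fun α v => (H.hasFDerivAt_η hy α).clm_apply (hasFDerivAt_const v y)
    have dΓ := hΓ.clm_apply (hasFDerivAt_const b y)
    have e := hasFDerivAt_eq_of_eqOn (H.mem_nhds hy) (fun z hz => hφ z hz b c)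
      (((hasFDerivAt_fderiv H.φ_contDiffOn (H.mem_nhds hy)).clm_apply
        (hasFDerivAt_const b y)).clm_apply (hasFDerivAt_const c y))
      ((((((((H.metric.hasFDerivAt hy).clm_apply (hasFDerivAt_const b y)).clm_apply
        (hasFDerivAt_const c y)).sub (HasFDerivAt.fun_sum fun α (_ : α ∈ Finset.univ) =>
          ((dη α b).const_mul (ε α)).mul (dη α c))).smul
        (HasFDerivAt.fun_sum fun α (_ : α ∈ Finset.univ) => H.hasFDerivAt_ξ hy α)).add
        ((HasFDerivAt.fun_sum fun α (_ : α ∈ Finset.univ) => (dη α c).const_mul (ε α)).smul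
        ((HasFDerivAt.fun_sum fun α (_ : α ∈ Finset.univ) =>
          (dη α b).smul (H.hasFDerivAt_ξ hy α)).const_add (-b)))).sub
        (dΓ.clm_apply ((H.hasFDerivAt_φ hy).clm_apply (hasFDerivAt_const c y)))).add
        ((H.hasFDerivAt_φ hy).clm_apply (dΓ.clm_apply (hasFDerivAt_const c y))))
    have e := congrArg (fun L : E →L[ℝ] E => L a) e
    simp [sum_apply, hb, hc] at e
    rw [e]
    module
  -- The Ricci identity for `φ` comes from the symmetry of its second derivative. Since `ξ̄` and
  -- `η̄` are parallel, only the commutator of `φ` with the curvature remains.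
  have s := congrArg (fun L : E →L[ℝ] E => L c)
    (fderiv_fderiv_symm H.φ_contDiffOn (H.mem_nhds hy) a b)
  rw [key a b hb, key b a ha, H.metric.fderiv_metric hy, H.metric.fderiv_metric hy,
    hφ y hy a c, hφ y hy b c, hφ y hy a (christoffel h y b c), hφ y hy b (christoffel h y a c)] at s
  have ca := hcov a
  have cb := hcov b
  have na := hcovη a c
  have nb := hcovη b c
  have ha := (H.gff y hy).mem_range_iff.1 ha
  have hb := (H.gff y hy).mem_range_iff.1 hb
  have hc := (H.gff y hy).mem_range_iff.1 hc
  simp only [mul_sub, Finset.sum_sub_distrib, Finset.sum_add_distrib] at ca cb na nb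
  simp only [coordCurvature, ha, hb, hc, map_sub, map_add, map_smul, mul_zero, zero_mul,
    Finset.sum_const_zero, zero_smul, sub_zero, add_zero, smul_neg, map_sum, neg_zero,
    H.metric.christoffel_symm hy b a] at s ⊢
  rw [sub_eq_zero] at na nb
  rw [na, nb, eq_neg_of_add_eq_zero_left ca, eq_neg_of_add_eq_zero_left cb] at s
  linear_combination (norm := module) -s

end IsCoordS
end CoordinateCurvature

/-! ### Passing from the manifold to a chart. -/

section Transfer

variable {E : Type*} [NormedAddCommGroup E] [NormedSpace ℝ E]
  {M : Type*} [TopologicalSpace M] [ChartedSpace E M] [IsManifold 𝓘(ℝ, E) ∞ M] {s : ℕ}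

/-- The frame map `E → T_q M` of the chart at `p`. -/
def frame (p q : M) : E →L[ℝ] TangentSpace 𝓘(ℝ, E) q :=
  (trivializationAt E (TangentSpace 𝓘(ℝ, E)) p).symmL ℝ q

/-- The coordinate map `T_q M → E` of the chart at `p`. -/
def coframe (p q : M) : TangentSpace 𝓘(ℝ, E) q →L[ℝ] E :=
  (trivializationAt E (TangentSpace 𝓘(ℝ, E)) p).continuousLinearMapAt ℝ q

theorem mem_baseSet {p q : M} (hq : q ∈ (extChartAt 𝓘(ℝ, E) p).source) :
    q ∈ (trivializationAt E (TangentSpace 𝓘(ℝ, E)) p).baseSet := by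
  simpa using hq

theorem frame_coframe {p q : M} (hq : q ∈ (extChartAt 𝓘(ℝ, E) p).source)
    (x : TangentSpace 𝓘(ℝ, E) q) : frame p q (coframe p q x) = x :=
  (trivializationAt E (TangentSpace 𝓘(ℝ, E)) p).symmL_continuousLinearMapAt (mem_baseSet hq) x

theorem coframe_frame {p q : M} (hq : q ∈ (extChartAt 𝓘(ℝ, E) p).source)
    (v : E) : coframe p q (frame p q v) = v :=
  (trivializationAt E (TangentSpace 𝓘(ℝ, E)) p).continuousLinearMapAt_symmL (mem_baseSet hq) v

theorem coframe_eq_trivialization {p q : M} (hq : q ∈ (extChartAt 𝓘(ℝ, E) p).source)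
    (x : TangentSpace 𝓘(ℝ, E) q) :
    coframe p q x = (trivializationAt E (TangentSpace 𝓘(ℝ, E)) p ⟨q, x⟩).2 := by
  rw [coframe, Bundle.Trivialization.continuousLinearMapAt_apply,
    Bundle.Trivialization.coe_linearMapAt_of_mem _ (mem_baseSet hq)]

theorem coframe_eq_mfderiv {p q : M} (hq : q ∈ (extChartAt 𝓘(ℝ, E) p).source) :
    coframe p q = mfderiv 𝓘(ℝ, E) 𝓘(ℝ, E) (extChartAt 𝓘(ℝ, E) p) q :=
  TangentBundle.continuousLinearMapAt_trivializationAt (by simpa using hq)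

theorem frame_self (p : M) (v : E) : frame p p v = v :=
  SemiRiemannianMetric.symmL_self p v

theorem coframe_self (p : M) (v : E) : coframe p p v = v := by
  conv_lhs => rw [← frame_self p v]
  exact coframe_frame (mem_extChartAt_source p) v

theorem inverse_mfderiv_extChartAt {p q : M} (hq : q ∈ (extChartAt 𝓘(ℝ, E) p).source) (v : E) :
    (mfderiv 𝓘(ℝ, E) 𝓘(ℝ, E) (extChartAt 𝓘(ℝ, E) p) q).inverse v = frame p q v := by
  refine (isInvertible_mfderiv_extChartAt hq).inverse_apply_eq.2 ?_
  rw [← coframe_eq_mfderiv hq]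
  exact (coframe_frame hq v).symm

theorem contMDiffOn_frame (p : M) (v : E) :
    ContMDiffOn 𝓘(ℝ, E) (𝓘(ℝ, E).prod 𝓘(ℝ, E)) ∞
      (fun q : M => Bundle.TotalSpace.mk' E (E := fun p : M => TangentSpace 𝓘(ℝ, E) p) q
        (frame p q v)) (extChartAt 𝓘(ℝ, E) p).source := by
  have hb : (extChartAt 𝓘(ℝ, E) p).source =
      (trivializationAt E (TangentSpace 𝓘(ℝ, E)) p).baseSet := by simp
  rw [hb, (trivializationAt E (TangentSpace 𝓘(ℝ, E)) p).contMDiffOn_section_baseSet_iff]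
  refine (contMDiffOn_const (c := v)).congr fun q hq => ?_
  rw [← hb] at hq
  rw [← coframe_eq_trivialization hq, coframe_frame hq]

theorem smoothFieldAt_frame {p q : M} (hq : q ∈ (extChartAt 𝓘(ℝ, E) p).source) (v : E) :
    SmoothFieldAt (fun q : M => frame p q v) q :=
  (contMDiffOn_frame p v).contMDiffAt ((isOpen_extChartAt_source p).mem_nhds hq)

theorem contDiffOn_coframe {p : M} {X : ∀ p : M, TangentSpace 𝓘(ℝ, E) p}
    (hX : ContMDiffOn 𝓘(ℝ, E) (𝓘(ℝ, E).prod 𝓘(ℝ, E)) ∞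
      (fun q => Bundle.TotalSpace.mk' E (E := fun p : M => TangentSpace 𝓘(ℝ, E) p) q (X q))
      (extChartAt 𝓘(ℝ, E) p).source) :
    ContDiffOn ℝ ∞ (fun y => coframe p _ (X ((extChartAt 𝓘(ℝ, E) p).symm y)))
      (extChartAt 𝓘(ℝ, E) p).target := by
  have hb : (extChartAt 𝓘(ℝ, E) p).source =
      (trivializationAt E (TangentSpace 𝓘(ℝ, E)) p).baseSet := by simp
  have h0 := hX
  rw [hb, (trivializationAt E (TangentSpace 𝓘(ℝ, E)) p).contMDiffOn_section_baseSet_iff, ← hb]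
    at h0
  have h1 : ContMDiffOn 𝓘(ℝ, E) 𝓘(ℝ, E) ∞ (fun q => coframe p q (X q))
      (extChartAt 𝓘(ℝ, E) p).source :=
    h0.congr fun q hq => coframe_eq_trivialization hq _
  exact (h1.comp (contMDiffOn_extChartAt_symm (n := ∞) (I := 𝓘(ℝ, E)) p)
    (extChartAt 𝓘(ℝ, E) p).symm.mapsTo).contDiffOn

/-- The Lie bracket of vector fields given in the chart at `p`. -/
theorem mlieBracket_frame [CompleteSpace E] {p q : M}
    (hq : q ∈ (extChartAt 𝓘(ℝ, E) p).source) {V W : E → E}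
    (hV : ContDiffAt ℝ ∞ V (extChartAt 𝓘(ℝ, E) p q))
    (hW : ContDiffAt ℝ ∞ W (extChartAt 𝓘(ℝ, E) p q))
    {X Y : ∀ q : M, TangentSpace 𝓘(ℝ, E) q}
    (hX : ∀ q ∈ (extChartAt 𝓘(ℝ, E) p).source, X q = frame p q (V (extChartAt 𝓘(ℝ, E) p q)))
    (hY : ∀ q ∈ (extChartAt 𝓘(ℝ, E) p).source, Y q = frame p q (W (extChartAt 𝓘(ℝ, E) p q))) :
    VectorField.mlieBracket 𝓘(ℝ, E) X Y q =
      frame p q (VectorField.lieBracket ℝ V W (extChartAt 𝓘(ℝ, E) p q)) := by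
  have hn := (isOpen_extChartAt_source (I := 𝓘(ℝ, E)) p).mem_nhds hq
  have key : ∀ {X : ∀ q : M, TangentSpace 𝓘(ℝ, E) q} {V : E → E},
      (∀ q ∈ (extChartAt 𝓘(ℝ, E) p).source, X q = frame p q (V (extChartAt 𝓘(ℝ, E) p q))) →
      -- Fields given in the frame are pull-backs under the chart, and pull-back commutes with the
      -- Lie bracket.
      X =ᶠ[𝓝 q] VectorField.mpullback 𝓘(ℝ, E) 𝓘(ℝ, E) (extChartAt 𝓘(ℝ, E) p) V := by
    intro X V hX
    filter_upwards [hn] with q' hq'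
    exact (hX q' hq').trans (inverse_mfderiv_extChartAt hq' _).symm
  have h2 : (2 : ℕ∞ω) ≤ ∞ := WithTop.coe_le_coe.2 (le_top : (2 : ℕ∞) ≤ ⊤)
  have : IsManifold 𝓘(ℝ, E) (minSmoothness ℝ 2) M := IsManifold.of_le (n := ∞) (by simpa using h2)
  have hs : ∀ {V : E → E}, ContDiffAt ℝ ∞ V (extChartAt 𝓘(ℝ, E) p q) →
      MDifferentiableAt 𝓘(ℝ, E) (𝓘(ℝ, E).prod 𝓘(ℝ, E))
        (fun x => (⟨x, V x⟩ : TangentBundle 𝓘(ℝ, E) E)) (extChartAt 𝓘(ℝ, E) p q) := by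
    intro V hV
    exact (contMDiffAt_vectorSpace_iff_contDiffAt.2 hV).mdifferentiableAt (by simp)
  refine ((key hX).mlieBracket_vectorField_eq (key hY)).trans ?_
  refine (VectorField.mpullback_mlieBracket (n := ∞) (hs hV) (hs hW)
    (contMDiffAt_extChartAt' (by simpa using hq)) (by simpa using h2)).symm.trans ?_
  refine (inverse_mfderiv_extChartAt hq _).trans ?_
  refine congrArg (frame p q) ?_
  have e := congrFun (VectorField.mlieBracketWithin_eq_lieBracketWithin (𝕜 := ℝ) (V := V)
    (W := W) (s := Set.univ)) (extChartAt 𝓘(ℝ, E) p q)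
  exact e.trans (congrFun (VectorField.lieBracketWithin_univ (𝕜 := ℝ) (E := E)) _)

theorem mvfderiv_frame {p q : M} (hq : q ∈ (extChartAt 𝓘(ℝ, E) p).source) {f : M → ℝ}
    {F : E → ℝ} (hF : DifferentiableAt ℝ F (extChartAt 𝓘(ℝ, E) p q))
    (hf : ∀ q ∈ (extChartAt 𝓘(ℝ, E) p).source, f q = F (extChartAt 𝓘(ℝ, E) p q)) (v : E) :
    mvfderiv 𝓘(ℝ, E) f q (frame p q v) = fderiv ℝ F (extChartAt 𝓘(ℝ, E) p q) v := by
  have hn := (isOpen_extChartAt_source (I := 𝓘(ℝ, E)) p).mem_nhds hq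
  have e : f =ᶠ[𝓝 q] F ∘ extChartAt 𝓘(ℝ, E) p := Filter.mem_of_superset hn hf
  have h1 : mfderiv 𝓘(ℝ, E) 𝓘(ℝ, ℝ) f q =
      (mfderiv 𝓘(ℝ, E) 𝓘(ℝ, ℝ) F (extChartAt 𝓘(ℝ, E) p q)).comp
        (mfderiv 𝓘(ℝ, E) 𝓘(ℝ, E) (extChartAt 𝓘(ℝ, E) p) q) := by
    rw [e.mfderiv_eq]
    exact mfderiv_comp q hF.mdifferentiableAt (mdifferentiableAt_extChartAt (by simpa using hq))
  change mfderiv 𝓘(ℝ, E) 𝓘(ℝ, ℝ) f q (frame p q v) = _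
  rw [h1, mfderiv_eq_fderiv, ← coframe_eq_mfderiv hq]
  change fderiv ℝ F (extChartAt 𝓘(ℝ, E) p q) (coframe p q (frame p q v)) = _
  rw [coframe_frame hq]

namespace GFFStructure

variable (S : GFFStructure E M s)

/-- The tensor field `φ` in the frame of the chart at `p`. -/
def frameφ (p q : M) : E →L[ℝ] E := coframe p q ∘L S.φ q ∘L frame p q

/-- The vector field `ξ_α` in the frame of the chart at `p`. -/
def frameξ (p : M) (α : Fin s) (q : M) : E := coframe p q (S.ξ α q)

/-- The form `η^α` in the frame of the chart at `p`. -/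
def frameη (p : M) (α : Fin s) (q : M) : E →L[ℝ] ℝ := S.η α q ∘L frame p q

theorem frameφ_apply (p q : M) (v : E) :
    S.frameφ p q v = coframe p q (S.φ q (frame p q v)) := rfl

theorem frameη_apply (p q : M) (α : Fin s) (v : E) :
    S.frameη p α q v = S.η α q (frame p q v) := rfl

theorem frame_frameφ {p q : M} (hq : q ∈ (extChartAt 𝓘(ℝ, E) p).source) (v : E) :
    frame p q (S.frameφ p q v) = S.φ q (frame p q v) := by
  rw [frameφ_apply, frame_coframe hq]

theorem frame_frameξ {p q : M} (hq : q ∈ (extChartAt 𝓘(ℝ, E) p).source) (α : Fin s) :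
    frame p q (S.frameξ p α q) = S.ξ α q :=
  frame_coframe hq _

theorem frameφ_contDiffOn [FiniteDimensional ℝ E] (p : M) :
    ContDiffOn ℝ ∞ (fun y => S.frameφ p ((extChartAt 𝓘(ℝ, E) p).symm y))
      (extChartAt 𝓘(ℝ, E) p).target := by
  rw [contDiffOn_clm_apply]
  intro v
  exact contDiffOn_coframe (X := fun q => S.φ q (frame p q v))
    (S.φ_contMDiff.contMDiffOn.clm_bundle_apply (contMDiffOn_frame p v))

theorem frameξ_contDiffOn (p : M) (α : Fin s) :
    ContDiffOn ℝ ∞ (fun y => S.frameξ p α ((extChartAt 𝓘(ℝ, E) p).symm y))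
      (extChartAt 𝓘(ℝ, E) p).target :=
  contDiffOn_coframe (S.ξ_contMDiff α).contMDiffOn

theorem frameη_contDiffOn [FiniteDimensional ℝ E] (p : M) (α : Fin s) :
    ContDiffOn ℝ ∞ (fun y => S.frameη p α ((extChartAt 𝓘(ℝ, E) p).symm y))
      (extChartAt 𝓘(ℝ, E) p).target := by
  rw [contDiffOn_clm_apply]
  intro v
  have h1 : ContMDiffOn 𝓘(ℝ, E) 𝓘(ℝ, ℝ) ∞ (fun q : M => S.η α q (frame p q v))
      (extChartAt 𝓘(ℝ, E) p).source := by
    intro q hq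
    have h3 := ((S.η_contMDiff α).contMDiffOn.clm_bundle_apply (F₂ := ℝ) (E₂ := Bundle.Trivial M ℝ)
      (contMDiffOn_frame p v)) q hq
    rw [Bundle.contMDiffWithinAt_section] at h3
    exact h3
  exact (h1.comp (contMDiffOn_extChartAt_symm (n := ∞) (I := 𝓘(ℝ, E)) p)
    (extChartAt 𝓘(ℝ, E) p).symm.mapsTo).contDiffOn

end GFFStructure

theorem SemiRiemannianMetric.isCoordMetric [FiniteDimensional ℝ E] (g : SemiRiemannianMetric E M)
    (p : M) : IsCoordMetric (extChartAt 𝓘(ℝ, E) p).target (g.inChart p) where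
  isOpen := isOpen_extChartAt_target p
  contDiffOn := g.inChart_contDiffOn p
  symm y _ := g.inChart_symm p y
  isInvertible _ hy := g.inChart_isInvertible p hy

namespace IndefiniteSStructure

variable (S : IndefiniteSStructure E M s)

theorem frameφ_self (p : M) : S.frameφ p p = S.φ p := by
  ext v
  rw [S.frameφ_apply, frame_self]
  exact coframe_self p _

theorem frameξ_self (p : M) (α : Fin s) : S.frameξ p α p = S.ξ α p :=
  coframe_self p _

theorem frameη_self (p : M) (α : Fin s) : S.frameη p α p = S.η α p := by
  ext v
  exact congrArg (S.η α p) (frame_self p v)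

theorem inChart_self_eq (p : M) : S.g.inChart p (extChartAt 𝓘(ℝ, E) p p) = S.g.val p := by
  ext v w
  exact S.g.inChart_self p v w

theorem isGFFAt_frame {p q : M} (hq : q ∈ (extChartAt 𝓘(ℝ, E) p).source) :
    IsGFFAt ((frame p q).precomp ℝ ∘L S.g.val q ∘L frame p q) (S.frameφ p q)
      (fun α => S.frameξ p α q) (fun α => S.frameη p α q) S.ε where
  symm v w := S.g.symm q _ _
  nondegenerate v hv := by
    rw [← coframe_frame hq v, S.g.nondegenerate q (frame p q v) fun w => ?_, map_zero]
    rw [← frame_coframe hq w]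
    exact hv _
  φ_φ x := by
    rw [S.frameφ_apply p q (S.frameφ p q x), S.frame_frameφ hq, S.φ_φ, map_add, map_neg,
      coframe_frame hq, map_sum]
    simp only [map_smul]
    rfl
  φ_ξ α := by
    have h : S.ξ α q ∈ (S.φ q).ker := by
      rw [S.ker_φ]
      exact Submodule.subset_span ⟨α, rfl⟩
    rw [S.frameφ_apply, S.frame_frameξ hq, show S.φ q (S.ξ α q) = 0 from h, map_zero]
  η_ξ α β := by
    rw [S.frameη_apply, S.frame_frameξ hq, S.η_ξ]
  ε_mul_self α := by
    rcases S.causal α with h | h <;> rw [h.1] <;> norm_num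
  compatible x y := by
    change S.g.val q (frame p q (S.frameφ p q x)) (frame p q (S.frameφ p q y)) = _
    rw [S.frame_frameφ hq, S.frame_frameφ hq, S.compatible]
    rfl

/-- An indefinite `S`-structure in the chart at `p`. -/
theorem isCoordS [FiniteDimensional ℝ E] (p : M) :
    IsCoordS (extChartAt 𝓘(ℝ, E) p).target (S.g.inChart p)
      (fun y => S.frameφ p ((extChartAt 𝓘(ℝ, E) p).symm y))
      (fun α y => S.frameξ p α ((extChartAt 𝓘(ℝ, E) p).symm y))
      (fun α y => S.frameη p α ((extChartAt 𝓘(ℝ, E) p).symm y)) S.ε where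
  metric := S.g.isCoordMetric p
  φ_contDiffOn := S.frameφ_contDiffOn p
  ξ_contDiffOn := S.frameξ_contDiffOn p
  η_contDiffOn := S.frameη_contDiffOn p
  gff y hy := S.isGFFAt_frame ((extChartAt 𝓘(ℝ, E) p).map_target hy)
  extDer α y hy v w := by
    have hq := (extChartAt 𝓘(ℝ, E) p).map_target hy
    have hyq := (extChartAt 𝓘(ℝ, E) p).right_inv hy
    have h1 := S.extDer_η α _ _ _ (smoothFieldAt_frame hq v) (smoothFieldAt_frame hq w)
    have hη := ((S.frameη_contDiffOn p α).contDiffAt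
      ((isOpen_extChartAt_target p).mem_nhds hy)).differentiableAt (by simp)
    have hd : ∀ v w, mvfderiv 𝓘(ℝ, E) (fun q => S.η α q (frame p q w))
        ((extChartAt 𝓘(ℝ, E) p).symm y) (frame p _ v) =
          fderiv ℝ (fun y => S.frameη p α ((extChartAt 𝓘(ℝ, E) p).symm y)) y v w := by
      intro v w
      have h2 := hη.hasFDerivAt.clm_apply (hasFDerivAt_const w y)
      have h3 := mvfderiv_frame (f := fun q => S.η α q (frame p q w)) hq
        (F := fun y => S.frameη p α ((extChartAt 𝓘(ℝ, E) p).symm y) w)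
        (by rw [hyq]; exact h2.differentiableAt)
        (fun q hq => by rw [(extChartAt 𝓘(ℝ, E) p).left_inv hq]; rfl) v
      rw [h3, hyq, h2.fderiv]
      simp
    have hb := mlieBracket_frame hq (V := fun _ => v) (W := fun _ => w)
      contDiffAt_const contDiffAt_const (X := fun q => frame p q v) (Y := fun q => frame p q w)
      (fun _ _ => rfl) (fun _ _ => rfl)
    -- Coordinate fields commute, so the bracket term of `dη^α` drops out.
    have h0 : VectorField.lieBracket ℝ (fun _ : E => v) (fun _ => w) = 0 := by
      ext; simp [VectorField.lieBracket]
    rw [extDer, hd, hd, hb, h0, Pi.zero_apply, map_zero, map_zero, ← S.frame_frameφ hq] at h1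
    rw [S.g.inChart_apply]
    change _ = S.g.val _ (frame p _ v) (frame p _ _) at h1
    change _ = 2 * S.g.val _ (frame p _ v) (frame p _ _)
    rw [← h1]
    ring
  normal y hy v w := by
    have hq := (extChartAt 𝓘(ℝ, E) p).map_target hy
    have hyq := (extChartAt 𝓘(ℝ, E) p).right_inv hy
    have h1 := S.normal _ _ _ (smoothFieldAt_frame hq v) (smoothFieldAt_frame hq w)
    have hφ := ((S.frameφ_contDiffOn p).contDiffAt ((isOpen_extChartAt_target p).mem_nhds hy))
    have hφv : ∀ v, ContDiffAt ℝ ∞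
        (fun y => S.frameφ p ((extChartAt 𝓘(ℝ, E) p).symm y) v)
        (extChartAt 𝓘(ℝ, E) p ((extChartAt 𝓘(ℝ, E) p).symm y)) := fun v => by
      rw [hyq]; exact hφ.clm_apply contDiffAt_const
    have hX : ∀ v, ∀ q ∈ (extChartAt 𝓘(ℝ, E) p).source, S.φ q (frame p q v) = frame p q
        (S.frameφ p ((extChartAt 𝓘(ℝ, E) p).symm (extChartAt 𝓘(ℝ, E) p q)) v) := fun v q hq => by
      rw [(extChartAt 𝓘(ℝ, E) p).left_inv hq, S.frame_frameφ hq]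
    have hfd : ∀ v, fderiv ℝ (fun y => S.frameφ p ((extChartAt 𝓘(ℝ, E) p).symm y) v) y =
        (fderiv ℝ (fun y => S.frameφ p ((extChartAt 𝓘(ℝ, E) p).symm y)) y).flip v := fun v => by
      rw [((hφ.differentiableAt (by simp)).hasFDerivAt.clm_apply (hasFDerivAt_const v y)).fderiv]
      simp
    have hc : ∀ v : E, ∀ q ∈ (extChartAt 𝓘(ℝ, E) p).source, frame p q v =
      frame p q ((fun _ : E => v) (extChartAt 𝓘(ℝ, E) p q)) := fun _ _ _ => rfl
    -- On coordinate fields the last bracket vanishes, and each of the others reduces to derivatives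
    -- of the matrix of `φ`.
    rw [nijenhuis, mlieBracket_frame hq (hφv v) (hφv w) (hX v) (hX w),
      mlieBracket_frame hq (hφv v) contDiffAt_const (hX v) (hc w),
      mlieBracket_frame hq contDiffAt_const (hφv w) (hc v) (hX w),
      mlieBracket_frame hq contDiffAt_const contDiffAt_const (hc v) (hc w)] at h1
    have h2 := congrArg (coframe (E := E) p ((extChartAt 𝓘(ℝ, E) p).symm y)) h1
    simp only [S.extDer_η _ _ _ _ (smoothFieldAt_frame hq v) (smoothFieldAt_frame hq w), hyq,
      VectorField.lieBracket, hfd] at h2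
    simp only [← S.frame_frameφ hq, fderiv_fun_const, Pi.zero_apply, zero_apply, sub_self,
      zero_sub, sub_zero, map_zero, map_add, map_sub, map_neg, map_sum, map_smul, coframe_frame hq,
      ContinuousLinearMap.flip_apply, add_zero, sub_neg_eq_add] at h2
    exact h2

end IndefiniteSStructure

end Transfer

/-! ### Symmetric operators with a single eigenvalue. -/

section Spectral

/-- An operator which is symmetric with respect to a positive definite form and all of whose
eigenvalues are equal to `k` is the multiplication by `k`. -/
theorem eq_smul_of_forall_eigenvalue_eq {W : Type*} [AddCommGroup W] [Module ℝ W]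
    [FiniteDimensional ℝ W] (B : W →ₗ[ℝ] W →ₗ[ℝ] ℝ) (hsymm : ∀ v w, B v w = B w v)
    (hpos : ∀ v, v ≠ 0 → 0 < B v v) (T : W →ₗ[ℝ] W) (hT : ∀ v w, B (T v) w = B v (T w)) (k : ℝ)
    (hk : ∀ c : ℝ, ∀ v, v ≠ 0 → T v = c • v → c = k) (v : W) : T v = k • v := by
  let core : InnerProductSpace.Core ℝ W :=
    { inner := fun v w => B v w
      conj_inner_symm := fun v w => hsymm w v
      re_inner_nonneg := fun v => by
        by_cases hv : v = 0
        · simp [hv]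
        · exact (hpos v hv).le
      add_left := fun u v w => by simp
      smul_left := fun u v r => by simp
      definite := fun v hv => by
        by_contra h
        exact (hpos v h).ne' hv }
  let : NormedAddCommGroup W := core.toNormedAddCommGroup
  let : InnerProductSpace ℝ W := InnerProductSpace.ofCore core.toCore
  have hTs : T.IsSymmetric := fun v w => hT v w
  have h1 := hTs.orthogonalComplement_iSup_eigenspaces_eq_bot
  rw [Submodule.orthogonal_eq_bot_iff] at h1
  -- The eigenspaces span by the spectral theorem, and the only one that can be non-zero is that of
  -- `k`.
  have h2 : (⨆ c, Module.End.eigenspace T c) ≤ Module.End.eigenspace T k := by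
    refine iSup_le fun c w hw => ?_
    by_cases h0 : w = 0
    · rw [h0]; exact Submodule.zero_mem _
    · rw [← hk c w h0 (Module.End.mem_eigenspace_iff.1 hw)]
      exact hw
  rw [h1] at h2
  exact Module.End.mem_eigenspace_iff.1 (h2 (Submodule.mem_top : v ∈ ⊤))

end Spectral

/-! ### Algebraic curvature tensors of Kähler type on `Im φ`. -/

section AlgebraicCurvature

variable {E : Type*} [NormedAddCommGroup E] [NormedSpace ℝ E] {ι : Type*} [Fintype ι]
  [DecidableEq ι]

/-- The algebraic identities satisfied by the curvature tensor `R` of an indefinite `S`-structure with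
`∑ ε_α = 0` on one tangent space. -/
structure IsSCurvature (h : E →L[ℝ] E →L[ℝ] ℝ) (φ : E →L[ℝ] E) (ξ : ι → E) (η : ι → E →L[ℝ] ℝ)
    (ε : ι → ℝ) (R : E → E → E → E) : Prop extends IsGFFAt h φ ξ η ε where
  add_left : ∀ a a' b c, R (a + a') b c = R a b c + R a' b c
  smul_left : ∀ (r : ℝ) a b c, R (r • a) b c = r • R a b c
  add_right : ∀ a b c c', R a b (c + c') = R a b c + R a b c'
  smul_right : ∀ (r : ℝ) a b c, R a b (r • c) = r • R a b c
  swap : ∀ a b c, R a b c = -R b a c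
  bianchi : ∀ a b c, R a b c + R b c a + R c a b = 0
  metric_self : ∀ a b c, h (R a b c) c = 0
  apply_ξ : ∀ a b α, R a b (ξ α) =
    ε α • ((∑ β, ε β * η β a) • φ (φ b) - (∑ β, ε β * η β b) • φ (φ a))
  apply_φ : ∀ a ∈ φ.range, ∀ b ∈ φ.range, ∀ c ∈ φ.range, R a b (φ c) = φ (R a b c)

namespace IsSCurvature

variable {h : E →L[ℝ] E →L[ℝ] ℝ} {φ : E →L[ℝ] E} {ξ : ι → E} {η : ι → E →L[ℝ] ℝ} {ε : ι → ℝ}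
  {R : E → E → E → E}

theorem add_middle (H : IsSCurvature h φ ξ η ε R) (a b b' c : E) :
    R a (b + b') c = R a b c + R a b' c := by
  rw [H.swap, H.add_left, H.swap a b, H.swap a b']; abel

theorem smul_middle (H : IsSCurvature h φ ξ η ε R) (r : ℝ) (a b c : E) :
    R a (r • b) c = r • R a b c := by
  rw [H.swap, H.smul_left, H.swap a b, smul_neg]

theorem zero_middle (H : IsSCurvature h φ ξ η ε R) (a c : E) : R a 0 c = 0 := by
  simpa using H.smul_middle 0 a 0 c

theorem metric_skew (H : IsSCurvature h φ ξ η ε R) (a b c d : E) :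
    h (R a b c) d = -h (R a b d) c := by
  have h1 := H.metric_self a b (c + d)
  rw [H.add_right, map_add, map_add, add_apply, add_apply, H.metric_self, H.metric_self] at h1
  linarith

theorem metric_swap (H : IsSCurvature h φ ξ η ε R) (a b c d : E) :
    h (R a b c) d = -h (R b a c) d := by
  rw [H.swap, map_neg, neg_apply]

theorem metric_bianchi (H : IsSCurvature h φ ξ η ε R) (a b c d : E) :
    h (R a b c) d + h (R b c a) d + h (R c a b) d = 0 := by
  rw [← add_apply, ← map_add, ← add_apply, ← map_add, H.bianchi, map_zero, zero_apply]

/-- The classical octahedron argument: four Bianchi identities combined with the two skew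
symmetries. -/
theorem metric_pair (H : IsSCurvature h φ ξ η ε R) (a b c d : E) :
    h (R a b c) d = h (R c d a) b := by
  have b1 := H.metric_bianchi a b c d
  have b2 := H.metric_bianchi b c d a
  have b3 := H.metric_bianchi c d a b
  have b4 := H.metric_bianchi d a b c
  have s1 := H.metric_skew a b c d
  have s2 := H.metric_skew b c a d
  have s3 := H.metric_skew c d a b
  have s4 := H.metric_skew d a b c
  have s5 := H.metric_skew c a b d
  have s6 := H.metric_skew b d a c
  have t5 := H.metric_swap c a d b
  have t6 := H.metric_swap b d c a
  have t7 := H.metric_swap c a b d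
  have t8 := H.metric_swap b d a c
  linarith

theorem φ_mem (_ : IsSCurvature h φ ξ η ε R) (x : E) : φ x ∈ φ.range := ⟨x, rfl⟩

theorem sum_η_eq_zero (H : IsSCurvature h φ ξ η ε R) {x : E} (hx : x ∈ φ.range) :
    ∑ β, ε β * η β x = 0 := by
  simp [H.mem_range_iff.1 hx]

theorem apply_ξ_of_mem (H : IsSCurvature h φ ξ η ε R) {a b : E} (ha : a ∈ φ.range)
    (hb : b ∈ φ.range) (α : ι) : R a b (ξ α) = 0 := by
  rw [H.apply_ξ, H.sum_η_eq_zero ha, H.sum_η_eq_zero hb]; simp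

/-- The operator `R(a, b)` is skew and annihilates every `ξ_α`, so its image is orthogonal to all of
them; that orthogonal complement is `Im φ`. -/
theorem mem_range (H : IsSCurvature h φ ξ η ε R) {a b : E} (ha : a ∈ φ.range)
    (hb : b ∈ φ.range) (c : E) : R a b c ∈ φ.range := by
  refine H.mem_range_iff.2 fun α => ?_
  have h1 := H.metric_skew a b c (ξ α)
  rw [H.apply_ξ_of_mem ha hb, map_zero, zero_apply, neg_zero, H.metric_ξ_right] at h1
  refine (mul_eq_zero.1 h1).resolve_left fun h0 => ?_
  simpa [h0] using H.ε_mul_self α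

theorem sum_η_ξ (H : IsSCurvature h φ ξ η ε R) (α : ι) : ∑ β, ε β * η β (ξ α) = ε α := by
  simp [H.η_ξ]

theorem metric_φ_φ_of_mem (H : IsSCurvature h φ ξ η ε R) {x : E} (hx : x ∈ φ.range) (y : E) :
    h (φ x) (φ y) = h x y := by
  rw [H.compatible]; simp [H.mem_range_iff.1 hx]

/-- The Jacobi operator of `u = ξ_α + x` on `u^⊥ ∩ Im φ`. -/
theorem jacobi_null (H : IsSCurvature h φ ξ η ε R) (α : ι) {x y : E} (hx : x ∈ φ.range)
    (hy : y ∈ φ.range) (hxy : h x y = 0) : R y (ξ α + x) (ξ α + x) = y + R y x x := by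
  have h1 : R y (ξ α) (ξ α) = y := by
    rw [H.apply_ξ, H.φ_ξ, H.sum_η_ξ, H.φ_φ_of_mem hy, map_zero, smul_zero, zero_sub, smul_neg,
      smul_neg, smul_neg, neg_neg, smul_smul, H.ε_mul_self, one_smul]
  -- By pair symmetry this is paired with `z` through `R(x, z)ξ_α`, a multiple of `x`, which is
  -- orthogonal to `y`.
  have h2 : R y (ξ α) x = 0 := by
    refine H.nondegenerate _ fun z => ?_
    rw [H.metric_pair, H.metric_skew, H.apply_ξ, H.sum_η_eq_zero hx, H.φ_φ_of_mem hx]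
    simp [hxy]
  rw [H.add_middle, H.add_right, H.add_right, h1, h2, H.apply_ξ_of_mem hy hx]
  abel

/-- The Jacobi operator of `u = ξ_α + x` on `ξ_β`. -/
theorem jacobi_null_ξ (H : IsSCurvature h φ ξ η ε R) {α β : ι} (hε : ε α = -1) (hβ : ε β = 1)
    (hsum : ∑ γ, ξ γ = ξ α + ξ β) {x : E} (hx : x ∈ φ.range) (hxx : h x x = 1) :
    R (ξ β) (ξ α + x) (ξ α + x) = ξ β + (ξ α + x) := by
  have h1 : R (ξ β) (ξ α) (ξ α) = 0 := by
    rw [H.apply_ξ, H.φ_ξ, H.φ_ξ]; simp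
  have h2 : R (ξ β) (ξ α) x = 0 := by
    refine H.nondegenerate _ fun z => ?_
    rw [H.metric_pair, H.apply_ξ]
    simp [H.metric_ξ_right, H.η_φ]
  have h3 : R (ξ β) x (ξ α) = x := by
    rw [H.apply_ξ, H.sum_η_eq_zero hx, H.sum_η_ξ, H.φ_φ_of_mem hx, hε, hβ]; simp
  -- By pair symmetry the product with `z` is `η̄(z) g(x, x) = η̄(z)`, and `η̄` is dual to `ξ̄`.
  have h4 : R (ξ β) x x = ∑ γ, ξ γ := by
    refine H.eq_of_forall fun z => ?_
    rw [H.metric_pair, H.apply_ξ, H.sum_η_eq_zero hx, H.φ_φ_of_mem hx, hβ]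
    simp [hxx, H.metric_ξ_left]
  rw [H.add_middle, H.add_right, H.add_right, h1, h2, h3, h4, hsum]
  abel

/-- If the Jacobi operators of the vectors of `Im φ` are scalar on their orthogonal complements in `Im φ`,
and every `x ∈ Im φ` has a non-zero vector of `Im φ` orthogonal to `x` and `φx`, then they
vanish. -/
theorem jacobi_eq_zero_of_scalar (H : IsSCurvature h φ ξ η ε R)
    (hpos : ∀ x ∈ φ.range, x ≠ 0 → 0 < h x x)
    (hdim : ∀ x : E, ∃ y ∈ φ.range, y ≠ 0 ∧ h x y = 0 ∧ h (φ x) y = 0)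
    (hscal : ∀ x ∈ φ.range, x ≠ 0 → ∃ k : ℝ, ∀ y ∈ φ.range, h x y = 0 → R y x x = (k * h x x) • y)
    {x y : E} (hx : x ∈ φ.range) (hy : y ∈ φ.range) (hxy : h x y = 0) : R y x x = 0 := by
  by_cases hx0 : x = 0
  · rw [hx0, H.zero_middle]
  -- A priori the scalar depends on the vector. For orthogonal `a, b`, the identity `h (R b a a) b =
  -- h (R a b b) a` shows that the scalars of `a` and `b` agree.
  have hconst : ∀ {a b : E} {k : ℝ}, a ∈ φ.range → b ∈ φ.range → a ≠ 0 → b ≠ 0 → h a b = 0 →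
      (∀ y ∈ φ.range, h a y = 0 → R y a a = (k * h a a) • y) →
      ∀ y ∈ φ.range, h b y = 0 → R y b b = (k * h b b) • y := by
    intro a b k ha hb ha0 hb0 hab hk
    obtain ⟨k', hk'⟩ := hscal b hb hb0
    have e1 := congrArg (fun v => h v b) (hk b hb hab)
    have e2 := congrArg (fun v => h v a) (hk' a ha (by rw [H.symm, hab]))
    have e3 := H.metric_pair b a a b
    simp only [map_smul, smul_apply, smul_eq_mul] at e1 e2
    rw [e1, e2] at e3
    have : k' = k := by
      have h1 := hpos a ha ha0
      have h2 := hpos b hb hb0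
      have h3 : (k - k') * (h a a * h b b) = 0 := by linear_combination e3
      have := (mul_eq_zero.1 h3).resolve_right (by positivity)
      linarith
    rwa [← this]
  obtain ⟨k, hk⟩ := hscal x hx hx0
  obtain ⟨z, hz, hz0, hxz, hφxz⟩ := hdim x
  set w := φ z with hw
  have hwm : w ∈ φ.range := H.φ_mem z
  have hww : h w w = h z z := H.metric_φ_φ_of_mem hz z
  have hw0 : w ≠ 0 := fun h0 => by
    have := hpos z hz hz0
    rw [← hww, h0, map_zero] at this
    exact lt_irrefl _ this
  have hzw : h z w = 0 := H.metric_φ_self z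
  have hxw : h x w = 0 := by rw [hw, H.metric_φ_right, hφxz, neg_zero]
  have hzx : h z x = 0 := by rw [H.symm, hxz]
  have hwx : h w x = 0 := by rw [H.symm, hxw]
  have hwz : h w z = 0 := by rw [H.symm, hzw]
  have kz := hconst hx hz hx0 hz0 hxz hk
  have kw := hconst hx hwm hx0 hw0 hxw hk
  -- Polarization: `b`, `c` and `b + c` share the scalar `k`, so the cross terms in `R(a, b + c)(b +
  -- c)` cancel.
  have alt : ∀ {a b c : E}, a ∈ φ.range → b ∈ φ.range → c ∈ φ.range → a ≠ 0 → b ≠ 0 →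
      h a b = 0 → h a c = 0 → h b c = 0 →
      (∀ y ∈ φ.range, h a y = 0 → R y a a = (k * h a a) • y) →
      (∀ y ∈ φ.range, h b y = 0 → R y b b = (k * h b b) • y) →
      (∀ y ∈ φ.range, h c y = 0 → R y c c = (k * h c c) • y) →
      R a b c + R a c b = 0 := by
    intro a b c ha hb hc ha0 hb0 hab hac hbc ka kb kc
    have hbc0 : b + c ≠ 0 := fun h0 => by
      have h1 := hpos b hb hb0
      have h2 : h b (b + c) = 0 := by rw [h0, map_zero]
      rw [map_add, hbc] at h2
      linarith
    have kbc := hconst ha (φ.range.add_mem hb hc) ha0 hbc0 (by rw [map_add, hab, hac, add_zero]) ka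
    have e1 := kbc a ha (by rw [H.symm, map_add, hab, hac, add_zero])
    have e2 := kb a ha (by rw [H.symm, hab])
    have e3 := kc a ha (by rw [H.symm, hac])
    rw [H.add_middle, H.add_right, H.add_right, e2, e3] at e1
    simp only [map_add, add_apply, hbc, H.symm c b] at e1
    linear_combination (norm := module) e1
  have a1 := alt hx hz hwm hx0 hz0 hxz hxw hzw hk kz kw
  have a2 := alt hz hx hwm hz0 hx0 hzx hzw hxw kz hk kw
  have bi := H.bianchi x z w
  have s1 := H.swap z x w
  have s2 := H.swap w x z
  -- The form `R(x, z)w` is alternating in the three orthogonal vectors, so the Bianchi identity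
  -- gives three times the same vector.
  have e : R x z w = 0 := by
    have : (3 : ℝ) • R x z w = 0 := by
      rw [s1] at a2
      rw [s2] at bi
      linear_combination (norm := module) bi - a2 + a1
    exact (smul_eq_zero.1 this).resolve_left (by norm_num)
  -- Here the Kähler symmetry enters: `0 = R(x, z)φz = φ(R(x, z)z) = k g(z, z) φx`, hence `k = 0`.
  rw [hw, H.apply_φ x hx z hz z hz, kz x hx hzx, map_smul] at e
  have hφx : φ x ≠ 0 := fun h0 => by
    have := hpos x hx hx0
    rw [← H.metric_φ_φ_of_mem hx, h0, map_zero] at this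
    exact lt_irrefl _ this
  have hk0 : k = 0 := by
    have h1 := (smul_eq_zero.1 e).resolve_right hφx
    exact (mul_eq_zero.1 h1).resolve_right (hpos z hz hz0).ne'
  rw [hk y hy hxy, hk0, zero_mul, zero_smul]

/-- Vanishing of the `φ`-sectional curvatures implies vanishing of the Jacobi operators on `Im φ`. -/
theorem jacobi_eq_zero_of_sectional (H : IsSCurvature h φ ξ η ε R)
    (hsec : ∀ x ∈ φ.range, h (R x (φ x) (φ x)) x = 0) {x y : E} (hx : x ∈ φ.range)
    (hy : y ∈ φ.range) : R y x x = 0 := by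
  have inv2 : ∀ a ∈ φ.range, ∀ b ∈ φ.range, ∀ c ∈ φ.range, ∀ d,
      h (R a b (φ c)) (φ d) = h (R a b c) d := by
    intro a ha b hb c hc d
    rw [H.apply_φ a ha b hb c hc, H.metric_φ_φ_of_mem (H.mem_range ha hb c)]
  have inv1 : ∀ a ∈ φ.range, ∀ b, ∀ c ∈ φ.range, ∀ d ∈ φ.range,
      h (R (φ a) (φ b) c) d = h (R a b c) d := by
    intro a ha b c hc d hd
    rw [H.metric_pair, inv2 c hc d hd a ha, H.metric_pair]
  -- Polarization of the hypothesis: its values at `x + y` and `x - y` are added, and the mixed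
  -- terms are reduced to two by the invariance under `φ` and the Bianchi identity.
  have key : ∀ x ∈ φ.range, ∀ y ∈ φ.range,
      3 * h (R x (φ y) (φ y)) x + h (R x y y) x = 0 := by
    intro x hx y hy
    have hJx := H.φ_mem x
    have hJy := H.φ_mem y
    have hxx := H.φ_φ_of_mem hx
    have hyy := H.φ_φ_of_mem hy
    have neg_mid : ∀ a b c d, h (R a (-b) c) d = -h (R a b c) d := fun a b c d => by
      rw [← neg_one_smul ℝ, H.smul_middle]; simp
    have neg_left : ∀ a b c d, h (R (-a) b c) d = -h (R a b c) d := fun a b c d => by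
      rw [← neg_one_smul ℝ, H.smul_left]; simp
    have neg_right : ∀ a b c d, h (R a b (-c)) d = -h (R a b c) d := fun a b c d => by
      rw [← neg_one_smul ℝ, H.smul_right]; simp
    have p1 := hsec _ (φ.range.add_mem hx hy)
    have p2 := hsec _ (φ.range.sub_mem hx hy)
    have p3 := hsec x hx
    have p4 := hsec y hy
    rw [sub_eq_add_neg] at p2
    simp only [map_add, map_neg, H.add_left, H.add_middle, H.add_right, add_apply,
      neg_left, neg_mid, neg_right, neg_neg] at p1 p2
    have i1 : ∀ c ∈ φ.range, ∀ d ∈ φ.range, h (R y (φ x) c) d = h (R x (φ y) c) d := by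
      intro c hc d hd
      rw [← inv1 y hy _ c hc d hd, hxx, neg_mid, H.metric_swap, neg_neg]
    have i2 : ∀ a ∈ φ.range, ∀ b ∈ φ.range, h (R a b (φ x)) y = h (R a b (φ y)) x := by
      intro a ha b hb
      rw [← inv2 a ha b hb _ hJx, hxx, neg_right, H.metric_skew, neg_neg]
    have r1 := i1 _ hJx _ hy
    have r2 := i1 _ hJy _ hx
    have r3 := i2 x hx _ hJy
    have r4 := H.metric_pair y (φ y) (φ x) x
    have r5 := H.metric_swap (φ x) x y (φ y)
    have r6 := H.metric_skew x (φ x) y (φ y)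
    have b1 := H.metric_bianchi x (φ x) (φ y) y
    have b2 := inv1 x hx y x hx y hy
    have b3 := H.metric_skew x y x y
    have b4 := H.metric_swap (φ y) x (φ x) y
    linarith
  have hdiag : ∀ y ∈ φ.range, h (R y x x) y = 0 := by
    intro y hy
    have k1 := key x hx y hy
    -- Replacing `y` by `φy` exchanges the two terms of `key`; the two resulting linear equations
    -- have only the zero solution.
    have k2 := key x hx (φ y) (H.φ_mem y)
    rw [H.φ_φ_of_mem hy, ← neg_one_smul ℝ y, H.smul_middle, H.smul_right] at k2
    simp only [neg_smul, one_smul, neg_neg] at k2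
    rw [H.metric_pair]
    linarith
  have hpolar : ∀ z ∈ φ.range, h (R y x x) z = 0 := by
    intro z hz
    have h1 := hdiag _ (φ.range.add_mem hy hz)
    simp only [H.add_left, map_add, add_apply, hdiag y hy, hdiag z hz] at h1
    have h2 := H.metric_pair z x x y
    have h3 := H.metric_swap x y z x
    have h4 := H.metric_skew y x z x
    linarith
  have hR := H.mem_range_iff.1 (H.mem_range hy hx x)
  refine H.nondegenerate _ fun z => ?_
  rw [H.decomposition z, map_add, hpolar _ (H.φ_mem _), map_sum]
  simp [H.metric_ξ_right, hR]

end IsSCurvature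
end AlgebraicCurvature

/-! ### Lorentz signature, and the curvature identities on the tangent spaces of `M`. -/

section Manifold

variable {E : Type*} [NormedAddCommGroup E] [NormedSpace ℝ E] [FiniteDimensional ℝ E]
  {M : Type*} [TopologicalSpace M] [ChartedSpace E M] [IsManifold 𝓘(ℝ, E) ∞ M]

/-- In a Lorentz tangent space the orthogonal complement of a timelike vector is positive definite. -/
theorem SemiRiemannianMetric.IsLorentz.pos_of_orthogonal {g : SemiRiemannianMetric E M}
    (hg : g.IsLorentz) {p : M} {z x : TangentSpace 𝓘(ℝ, E) p} (hz : g.val p z z < 0)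
    (hzx : g.val p z x = 0) (hx : x ≠ 0) : 0 < g.val p x x := by
  -- A vector `y` with `g(y, y) < 0` orthogonal to `z` would span with `z` a negative definite
  -- plane, contrary to index 1.
  have nonneg : ∀ y, g.val p z y = 0 → 0 ≤ g.val p y y := by
    intro y hzy
    by_contra! hy
    have hval : ∀ a b : ℝ, g.val p (a • z + b • y) (a • z + b • y) =
        a ^ 2 * g.val p z z + b ^ 2 * g.val p y y := by
      intro a b
      simp only [map_add, map_smul, add_apply, smul_apply, smul_eq_mul, g.symm p y z, hzy]
      ring
    have hneg : ∀ a b : ℝ, a ≠ 0 ∨ b ≠ 0 →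
        a ^ 2 * g.val p z z + b ^ 2 * g.val p y y < 0 := by
      rintro a b (h | h)
      · have := mul_neg_of_pos_of_neg (pow_pos (abs_pos.2 h) 2) hz
        rw [sq_abs] at this
        nlinarith [sq_nonneg b]
      · have := mul_neg_of_pos_of_neg (pow_pos (abs_pos.2 h) 2) hy
        rw [sq_abs] at this
        nlinarith [sq_nonneg a]
    have hind : LinearIndependent ℝ ![z, y] := by
      rw [LinearIndependent.pair_iff]
      intro a b hab
      by_contra! hne
      have h1 := hneg a b (by by_contra! h; exact hne h.1 h.2)
      rw [← hval, hab] at h1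
      simp at h1
    have hle := le_sigNeg_of_negDef (g.quadraticForm p)
      (V := Submodule.span ℝ (Set.range ![z, y])) (by
        rintro ⟨v, hv⟩ hv0
        have hv' := hv
        rw [Matrix.range_cons, Matrix.range_cons, Matrix.range_empty, Set.union_empty,
          Set.singleton_union, Submodule.mem_span_pair] at hv'
        obtain ⟨a, b, rfl⟩ := hv'
        have hab : a ≠ 0 ∨ b ≠ 0 := by
          by_contra! h
          exact hv0 (Subtype.ext (by simp [h.1, h.2]))
        have h1 := hneg a b hab
        rw [← hval] at h1
        change 0 < -(g.val p (a • z + b • y) (a • z + b • y))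
        linarith)
    rw [finrank_span_eq_card hind, hg p] at hle
    simp at hle
  rcases (nonneg x hzx).lt_or_eq with h | h
  · exact h
  · exfalso
    refine hx (g.nondegenerate p x fun w => ?_)
    by_contra hw
    -- the component of `w` orthogonal to `z`
    set c := g.val p z w / g.val p z z with hc
    have hw' : g.val p z (w - c • z) = 0 := by
      rw [map_sub, map_smul, smul_eq_mul, hc, div_mul_cancel₀ _ hz.ne, sub_self]
    have hxw : g.val p x (w - c • z) = g.val p x w := by
      rw [map_sub, map_smul, g.symm p x z, hzx, smul_zero, sub_zero]
    set v := w - c • z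
    set m := g.val p x w
    -- If `g(x, x) = 0`, then `g(tx + v, tx + v)` is affine in `t` and bounded below, so its slope
    -- must vanish; the value of `t` chosen next makes it `-1`.
    have key : ∀ t : ℝ, 0 ≤ 2 * t * m + g.val p v v := by
      intro t
      have h1 := nonneg (t • x + v) (by rw [map_add, map_smul, hzx, hw', smul_zero, add_zero])
      simp only [map_add, map_smul, add_apply, smul_apply, smul_eq_mul, g.symm p v x, hxw,
        ← h] at h1
      linarith
    have := key (-(g.val p v v + 1) / (2 * m))
    have e : 2 * (-(g.val p v v + 1) / (2 * m)) * m = -(g.val p v v + 1) := by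
      field_simp
    linarith

namespace IndefiniteSStructure

variable {s : ℕ} (S : IndefiniteSStructure E M s)

/-- At the centre of the chart the frame is the identity of `T_p M`, so the coordinate identities
hold verbatim there. The same reading gives `isSCurvature`. -/
theorem isGFFAt (p : M) :
    IsGFFAt (E := E) (S.g.val p) (S.φ p) (fun α => S.ξ α p) (fun α => S.η α p) S.ε := by
  have G := (S.isCoordS p).gff _ (mem_extChartAt_target p)
  simp only [extChartAt_to_inv, S.inChart_self_eq, S.frameφ_self, S.frameξ_self,
    S.frameη_self] at G
  exact G

theorem isSCurvature [NeZero s] (hε : ∑ α, S.ε α = 0) (p : M) :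
    IsSCurvature (E := E) (S.g.val p) (S.φ p) (fun α => S.ξ α p) (fun α => S.η α p) S.ε
      (fun a b c => S.g.curvature p a b c) := by
  have H := S.isCoordS p
  have hy := mem_extChartAt_target (I := 𝓘(ℝ, E)) p
  have Rξ := H.coordCurvature_ξ hy
  have Rφ := fun a b c => H.coordCurvature_φ hε hy (a := a) (b := b) (c := c)
  have Rm := H.metric.coordCurvature_metric_self hy
  simp only [extChartAt_to_inv, S.inChart_self_eq, S.frameφ_self, S.frameξ_self,
    S.frameη_self] at Rξ Rφ Rm
  exact
    { toIsGFFAt := S.isGFFAt p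
      add_left := fun a a' b c => coordCurvature_add _ _ a a' b c
      smul_left := fun r a b c => coordCurvature_smul _ _ r a b c
      add_right := fun a b c c' => coordCurvature_add_right _ _ a b c c'
      smul_right := fun r a b c => coordCurvature_smul_right _ _ r a b c
      swap := fun a b c => coordCurvature_swap _ _ a b c
      bianchi := fun a b c => H.metric.coordCurvature_bianchi hy a b c
      metric_self := Rm
      apply_ξ := fun a b α => Rξ α a b
      apply_φ := fun a ha b hb c hc => Rφ a b c ha hb hc }

end IndefiniteSStructure
end Manifold

/-! ### Null vectors `ξ_0 + x`, their Jacobi operators, and the equivalence. -/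

section Main

variable {E : Type*} [NormedAddCommGroup E] [NormedSpace ℝ E]
  {M : Type*} [TopologicalSpace M] [ChartedSpace E M] [IsManifold 𝓘(ℝ, E) ∞ M]

namespace IndefiniteSStructure

variable (S : IndefiniteSStructure E M 2)

theorem ε_zero {p : M} (ht : S.g.val p (S.ξ 0 p) (S.ξ 0 p) < 0) : S.ε 0 = -1 := by
  rcases S.causal 0 with h | h
  · exact absurd ht (h.2 p).not_gt
  · exact h.1

theorem mem_orthImage_iff {p : M} {x : TangentSpace 𝓘(ℝ, E) p}
    {w : S.g.OrthQuotient p (S.ξ 0 p + x)} :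
    w ∈ S.orthImage p (S.ξ 0 p + x) ↔
      ∃ y, ∃ hyu : y ∈ S.g.orth p (S.ξ 0 p + x), y ∈ (S.φ p).range ∧
        Submodule.Quotient.mk ⟨y, hyu⟩ = w := by
  constructor
  · rintro ⟨⟨y, hyu⟩, hy, rfl⟩
    exact ⟨y, hyu, hy, rfl⟩
  · rintro ⟨y, hyu, hy, rfl⟩
    exact ⟨⟨y, hyu⟩, hy, rfl⟩

variable [FiniteDimensional ℝ E]

theorem metric_ξ (p : M) (α : Fin 2) (x : TangentSpace 𝓘(ℝ, E) p) :
    S.g.val p (S.ξ α p) x = S.ε α * S.η α p x :=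
  (S.isGFFAt p).metric_ξ_left α x

/-- A non-zero vector orthogonal to the timelike `ξ_0` must be spacelike. -/
theorem ε_one (hL : S.g.IsLorentz) {p : M} (ht : S.g.val p (S.ξ 0 p) (S.ξ 0 p) < 0) :
    S.ε 1 = 1 := by
  rcases S.causal 1 with h | h
  · exact h.1
  · have h01 : S.g.val p (S.ξ 0 p) (S.ξ 1 p) = 0 := by
      rw [S.metric_ξ, S.η_ξ]
      simp
    have hne : S.ξ 1 p ≠ 0 := fun h0 => by
      have := S.η_ξ p 1 1
      rw [h0, map_zero] at this
      simp at this
    exact absurd (hL.pos_of_orthogonal ht h01 hne) (h.2 p).not_gt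

theorem sum_ε (hL : S.g.IsLorentz) {p : M} (ht : S.g.val p (S.ξ 0 p) (S.ξ 0 p) < 0) :
    ∑ α, S.ε α = 0 := by
  rw [Fin.sum_univ_two, S.ε_zero ht, S.ε_one hL ht]; norm_num

theorem metric_ξ_of_mem_range {p : M} {x : TangentSpace 𝓘(ℝ, E) p} (hx : x ∈ (S.φ p).range)
    (α : Fin 2) : S.g.val p (S.ξ α p) x = 0 := by
  refine ((S.isGFFAt p).metric_ξ_left α x).trans ?_
  rw [(S.isGFFAt p).mem_range_iff.1 hx α, mul_zero]

theorem pos_of_mem_range (hL : S.g.IsLorentz) {p : M}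
    (ht : S.g.val p (S.ξ 0 p) (S.ξ 0 p) < 0) {x : TangentSpace 𝓘(ℝ, E) p}
    (hx : x ∈ (S.φ p).range) (hx0 : x ≠ 0) : 0 < S.g.val p x x :=
  hL.pos_of_orthogonal ht (S.metric_ξ_of_mem_range hx 0) hx0

/-- Four linear conditions: the two forms `η^α`, which cut out `Im φ`, and orthogonality to `x` and
`φx`. This is where the dimension is required to exceed 4. -/
theorem exists_orthogonal (hE : 4 < Module.finrank ℝ E) (p : M) (x : TangentSpace 𝓘(ℝ, E) p) :
    ∃ y ∈ (S.φ p).range, y ≠ 0 ∧ S.g.val p x y = 0 ∧ S.g.val p (S.φ p x) y = 0 := by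
  let f : E →ₗ[ℝ] Fin 4 → ℝ := LinearMap.pi ![(S.η 0 p).toLinearMap, (S.η 1 p).toLinearMap,
    (S.g.val p x).toLinearMap, (S.g.val p (S.φ p x)).toLinearMap]
  have hf : LinearMap.ker f ≠ ⊥ := LinearMap.ker_ne_bot_of_finrank_lt (by simpa using hE)
  obtain ⟨y, hy, hy0⟩ := (Submodule.ne_bot_iff _).1 hf
  have h := fun i => congrFun (LinearMap.mem_ker.1 hy) i
  refine ⟨y, (S.isGFFAt p).mem_range_iff.2 fun α => ?_, hy0, h 2, h 3⟩
  fin_cases α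
  · exact h 0
  · exact h 1

theorem phiNullCongruence_null {p : M} (ht : S.g.val p (S.ξ 0 p) (S.ξ 0 p) < 0)
    {x : TangentSpace 𝓘(ℝ, E) p} (hx : x ∈ (S.φ p).range) (hxx : S.g.val p x x = 1) :
    S.ξ 0 p + x ≠ 0 ∧ S.g.val p (S.ξ 0 p + x) (S.ξ 0 p + x) = 0 := by
  have h00 : S.g.val p (S.ξ 0 p) (S.ξ 0 p) = -1 := by
    rw [S.metric_ξ, S.η_ξ, S.ε_zero ht]; simp
  refine ⟨fun h0 => ?_, ?_⟩
  · have h1 : S.η 0 p (S.ξ 0 p + x) = 1 := by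
      rw [map_add, S.η_ξ, show S.η 0 p x = 0 from (S.isGFFAt p).mem_range_iff.1 hx 0]; simp
    rw [h0, map_zero] at h1
    exact zero_ne_one h1
  · rw [map_add, map_add, add_apply, add_apply, h00, hxx, S.metric_ξ_of_mem_range hx,
      S.g.symm p x, S.metric_ξ_of_mem_range hx]
    norm_num

section NullVector

variable {p : M} {x : TangentSpace 𝓘(ℝ, E) p}

theorem mem_orth_iff {y : TangentSpace 𝓘(ℝ, E) p} (hy : y ∈ (S.φ p).range) :
    y ∈ S.g.orth p (S.ξ 0 p + x) ↔ S.g.val p x y = 0 := by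
  change S.g.val p (S.ξ 0 p + x) y = 0 ↔ _
  rw [map_add, add_apply, S.metric_ξ_of_mem_range hy, zero_add]

/-- A multiple of `ξ_0 + x` lies in `Im φ` only if it vanishes. -/
theorem eq_zero_of_mem_span {y : TangentSpace 𝓘(ℝ, E) p} (hx : x ∈ (S.φ p).range)
    (hy : y ∈ (S.φ p).range) (h : y ∈ Submodule.span ℝ {S.ξ 0 p + x}) : y = 0 := by
  obtain ⟨c, rfl⟩ := Submodule.mem_span_singleton.1 h
  have h1 : S.η 0 p (c • (S.ξ 0 p + x)) = 0 := (S.isGFFAt p).mem_range_iff.1 hy 0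
  have h2 : S.η 0 p x = 0 := (S.isGFFAt p).mem_range_iff.1 hx 0
  rw [map_smul, map_add, S.η_ξ, h2] at h1
  simp at h1
  rw [h1, zero_smul]

theorem jacobi_null (hε : ∑ α, S.ε α = 0) {y : TangentSpace 𝓘(ℝ, E) p} (hx : x ∈ (S.φ p).range)
    (hy : y ∈ (S.φ p).range) (hxy : S.g.val p x y = 0) :
    S.g.jacobi p (S.ξ 0 p + x) y = y + S.g.jacobi p x y :=
  (S.isSCurvature hε p).jacobi_null 0 hx hy hxy

theorem jacobi_mem_range (hε : ∑ α, S.ε α = 0) {y : TangentSpace 𝓘(ℝ, E) p}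
    (hx : x ∈ (S.φ p).range) (hy : y ∈ (S.φ p).range) : S.g.jacobi p x y ∈ (S.φ p).range :=
  (S.isSCurvature hε p).mem_range hy hx x

/-- The eigenvectors of `R̄_u`, `u = ξ_0 + x`, in the image of `u^⊥ ∩ Im φ`. -/
theorem jacobiBar_mk_eq_iff (hε : ∑ α, S.ε α = 0) (hx : x ∈ (S.φ p).range)
    {y : TangentSpace 𝓘(ℝ, E) p} (hy : y ∈ (S.φ p).range)
    (hyu : y ∈ S.g.orth p (S.ξ 0 p + x)) (μ : ℝ) :
    S.g.jacobiBar p (S.ξ 0 p + x) (Submodule.Quotient.mk ⟨y, hyu⟩) =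
      μ • Submodule.Quotient.mk ⟨y, hyu⟩ ↔ S.g.jacobi p x y = (μ - 1) • y := by
  have hxy := (S.mem_orth_iff hy).1 hyu
  have e : S.g.jacobiBar p (S.ξ 0 p + x) (Submodule.Quotient.mk ⟨y, hyu⟩) =
      Submodule.Quotient.mk ⟨S.g.jacobi p (S.ξ 0 p + x) y, S.g.jacobi_mem_orth p _ y⟩ := rfl
  rw [e, ← Submodule.Quotient.mk_smul, Submodule.Quotient.eq]
  change S.g.jacobi p (S.ξ 0 p + x) y - μ • y ∈ Submodule.span ℝ {S.ξ 0 p + x} ↔ _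
  rw [S.jacobi_null hε hx hy hxy]
  -- The difference lies in `Im φ`, which meets `span{u}` only in zero, so an eigenvalue equation
  -- modulo `u` is an honest equation.
  have e2 : y + S.g.jacobi p x y - μ • y = S.g.jacobi p x y - (μ - 1) • y := by module
  rw [e2, ← sub_eq_zero]
  constructor
  · exact S.eq_zero_of_mem_span hx
      (Submodule.sub_mem _ (S.jacobi_mem_range hε hx hy) (Submodule.smul_mem _ _ hy))
  · intro h
    rw [h]
    exact Submodule.zero_mem _

theorem mk_ne_zero (hx : x ∈ (S.φ p).range)
    {y : TangentSpace 𝓘(ℝ, E) p} (hy : y ∈ (S.φ p).range)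
    (hyu : y ∈ S.g.orth p (S.ξ 0 p + x)) (hy0 : y ≠ 0) :
    (Submodule.Quotient.mk ⟨y, hyu⟩ : S.g.OrthQuotient p (S.ξ 0 p + x)) ≠ 0 := by
  rw [Ne, Submodule.Quotient.mk_eq_zero]
  exact fun h => hy0 (S.eq_zero_of_mem_span hx hy h)

/-- If `R̄_u` has the single eigenvalue `μ`, then the Jacobi operator of `x` is scalar on
`x^⊥ ∩ Im φ`. -/
theorem jacobi_eq_smul (hε : ∑ α, S.ε α = 0)
    (hpos : ∀ y ∈ (S.φ p).range, y ≠ 0 → 0 < S.g.val p y y) (hx : x ∈ (S.φ p).range) {μ : ℝ}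
    (hμ : S.HasSingleEigenvalue p (S.ξ 0 p + x) μ) {y : TangentSpace 𝓘(ℝ, E) p}
    (hy : y ∈ (S.φ p).range) (hxy : S.g.val p x y = 0) : S.g.jacobi p x y = (μ - 1) • y := by
  have H := S.isSCurvature hε p
  let W : Submodule ℝ (TangentSpace 𝓘(ℝ, E) p) := (S.φ p).range ⊓ S.g.orth p x
  have hmaps : ∀ y ∈ W, S.g.jacobi p x y ∈ W := fun y hy =>
    ⟨S.jacobi_mem_range hε hx hy.1, S.g.jacobi_mem_orth p x y⟩
  let B : W →ₗ[ℝ] W →ₗ[ℝ] ℝ :=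
    ((ContinuousLinearMap.coeLM ℝ).comp (S.g.val p).toLinearMap).domRestrict₁₂ W W
  have hB : ∀ v w : W, B v w = S.g.val p v w := fun v w => rfl
  -- The Jacobi operator of `x` is symmetric by pair symmetry, and each of its eigenvalues `c` on
  -- `W` is an eigenvalue `c + 1` of `R̄_u`.
  have key := eq_smul_of_forall_eigenvalue_eq B (fun v w => S.g.symm p v w)
    (fun v hv => hpos v v.2.1 fun h0 => hv (Subtype.ext h0))
    ((S.g.jacobi p x).restrict hmaps)
    (fun v w => by
      rw [hB, hB]
      have h1 : S.g.val p (S.g.jacobi p x v) w = S.g.val p (S.g.jacobi p x w) v := by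
        have h2 := H.metric_pair v.1 x x w.1
        have h3 := H.metric_swap x w.1 v.1 x
        have h4 := H.metric_skew w.1 x v.1 x
        exact h2.trans (h3.trans (neg_eq_iff_eq_neg.2 h4))
      exact h1.trans (S.g.symm p _ _))
    (μ - 1) (fun c v hv hc => by
      have hvu : (v : TangentSpace 𝓘(ℝ, E) p) ∈ S.g.orth p (S.ξ 0 p + x) :=
        (S.mem_orth_iff v.2.1).2 v.2.2
      have hc' : S.g.jacobi p x v = ((c + 1) - 1) • (v : TangentSpace 𝓘(ℝ, E) p) := by
        rw [add_sub_cancel_right]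
        exact congrArg Subtype.val hc
      have h1 : c + 1 ∈ S.restrictedEigenvalues p (S.ξ 0 p + x) :=
        ⟨_, S.mem_orthImage_iff.2 ⟨v, hvu, v.2.1, rfl⟩,
          S.mk_ne_zero hx v.2.1 hvu fun h0 => hv (Subtype.ext h0),
          (S.jacobiBar_mk_eq_iff hε hx v.2.1 hvu _).2 hc'⟩
      rw [hμ] at h1
      rw [← Set.mem_singleton_iff.1 h1]
      ring) ⟨y, hy, hxy⟩
  exact congrArg Subtype.val key

/-- If the Jacobi operator of `x` vanishes on `x^⊥ ∩ Im φ`, then `R̄_u` has the single eigenvalue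
`1`. -/
theorem hasSingleEigenvalue_one (hε : ∑ α, S.ε α = 0) (hx : x ∈ (S.φ p).range) (hx0 : x ≠ 0)
    (hR : ∀ y ∈ (S.φ p).range, S.g.val p x y = 0 → S.g.jacobi p x y = 0) :
    S.HasSingleEigenvalue p (S.ξ 0 p + x) 1 := by
  have H := S.isSCurvature hε p
  ext μ
  rw [Set.mem_singleton_iff]
  constructor
  · rintro ⟨w, hw, hw0, hwμ⟩
    obtain ⟨y, hyu, hy, rfl⟩ := S.mem_orthImage_iff.1 hw
    have h1 := (S.jacobiBar_mk_eq_iff hε hx hy hyu μ).1 hwμ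
    rw [hR y hy ((S.mem_orth_iff hy).1 hyu)] at h1
    have hy0 : y ≠ 0 := fun h0 => hw0 (by
      rw [Submodule.Quotient.mk_eq_zero]
      exact (Submodule.mem_comap.2 (by simp [h0])))
    have := (smul_eq_zero.1 h1.symm).resolve_right hy0
    linarith
  · rintro rfl
    have hy : S.φ p x ∈ (S.φ p).range := ⟨x, rfl⟩
    have hxy : S.g.val p x (S.φ p x) = 0 := H.metric_φ_self x
    have hyu := (S.mem_orth_iff hy).2 hxy
    have hy0 : S.φ p x ≠ 0 := fun h0 => hx0 (by
      have h1 : S.φ p (S.φ p x) = -x := H.φ_φ_of_mem hx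
      rw [h0, map_zero] at h1
      exact neg_eq_zero.1 h1.symm)
    refine ⟨_, S.mem_orthImage_iff.2 ⟨_, hyu, hy, rfl⟩, S.mk_ne_zero hx hy hyu hy0,
      (S.jacobiBar_mk_eq_iff hε hx hy hyu 1).2 ?_⟩
    rw [hR _ hy hxy, sub_self, zero_smul]

/-- If the Jacobi operator of `x` vanishes on `x^⊥ ∩ Im φ`, then `R̄_u` is the identity. -/
theorem jacobiBar_eq_id (hL : S.g.IsLorentz) (ht : S.g.val p (S.ξ 0 p) (S.ξ 0 p) < 0)
    (hx : x ∈ (S.φ p).range) (hxx : S.g.val p x x = 1)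
    (hR : ∀ y ∈ (S.φ p).range, S.g.val p x y = 0 → S.g.jacobi p x y = 0) :
    S.g.jacobiBar p (S.ξ 0 p + x) = LinearMap.id := by
  have hε := S.sum_ε hL ht
  have H := S.isSCurvature hε p
  ext ⟨z, hz⟩
  change Submodule.Quotient.mk ⟨S.g.jacobi p (S.ξ 0 p + x) z, S.g.jacobi_mem_orth p _ z⟩ =
    (Submodule.Quotient.mk ⟨z, hz⟩ : S.g.OrthQuotient p (S.ξ 0 p + x))
  rw [Submodule.Quotient.eq]
  change S.g.jacobi p (S.ξ 0 p + x) z - z ∈ Submodule.span ℝ {S.ξ 0 p + x}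
  -- `z = a u + b ξ_1 + y`
  set u := S.ξ 0 p + x with hu
  set a := S.η 0 p z with ha
  set b := S.η 1 p z with hb
  set y := z - a • u - b • S.ξ 1 p with hy
  have hxη : ∀ α, S.η α p x = 0 := fun α => H.mem_range_iff.1 hx α
  have hym : y ∈ (S.φ p).range := by
    refine H.mem_range_iff.2 fun α => ?_
    change S.η α p y = 0
    rw [hy, hu, map_sub, map_sub, map_smul, map_smul, map_add, S.η_ξ, S.η_ξ, hxη]
    fin_cases α <;> simp [ha, hb]
  have hux : S.g.val p u u = 0 := (S.phiNullCongruence_null ht hx hxx).2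
  have hu1 : S.g.val p u (S.ξ 1 p) = 0 := by
    have h01 : S.g.val p (S.ξ 0 p) (S.ξ 1 p) = 0 := by
      rw [S.metric_ξ, S.η_ξ]; simp
    rw [hu, map_add, add_apply, h01, S.g.symm p x, S.metric_ξ_of_mem_range hx, add_zero]
  have hxy : S.g.val p x y = 0 := by
    refine (S.mem_orth_iff hym).1 ?_
    change S.g.val p u y = 0
    rw [hy, map_sub, map_sub, map_smul, map_smul, hux, hu1, show S.g.val p u z = 0 from hz]
    simp
  have h1 : S.g.jacobi p u (S.ξ 1 p) = S.ξ 1 p + u :=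
    H.jacobi_null_ξ (α := 0) (β := 1) (S.ε_zero ht) (S.ε_one hL ht) (Fin.sum_univ_two _) hx hxx
  have h2 : S.g.jacobi p u y = y := by
    rw [hu, S.jacobi_null hε hx hym hxy, hR y hym hxy, add_zero]
  have h3 : z = y + a • u + b • S.ξ 1 p := by rw [hy]; abel
  -- The Jacobi operator fixes `y`, annihilates `u`, and sends `ξ_1` to `ξ_1 + u`; hence it is the
  -- identity modulo `u`.
  have h4 : S.g.jacobi p u z - z = (b - a) • u := by
    conv_lhs => rw [h3]
    rw [map_add, map_add, map_smul, map_smul, h1, h2, S.g.jacobi_self]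
    module
  rw [h4]
  exact Submodule.smul_mem _ _ (Submodule.mem_span_singleton_self _)

end NullVector

/-- The dimension of `u^⊥ / span{u}` does not depend on the null vector `u ≠ 0`. -/
theorem finrank_orthQuotient {p : M} {u : TangentSpace 𝓘(ℝ, E) p} (hu : u ≠ 0)
    (huu : S.g.val p u u = 0) :
    Module.finrank ℝ (S.g.OrthQuotient p u) = Module.finrank ℝ E - 2 := by
  have hf : (S.g.val p u).toLinearMap ≠ 0 := fun h0 =>
    hu (S.g.nondegenerate p u fun w => LinearMap.congr_fun h0 w)
  have h1 : Module.finrank ℝ (S.g.orth p u) + 1 = Module.finrank ℝ E :=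
    Module.Dual.finrank_ker_add_one_of_ne_zero hf
  have hle : Submodule.span ℝ {u} ≤ S.g.orth p u :=
    (Submodule.span_singleton_le_iff_mem _ _).2 huu
  have h2 : Module.finrank ℝ ((Submodule.span ℝ {u}).submoduleOf (S.g.orth p u)) = 1 := by
    rw [(Submodule.submoduleOfEquivOfLe hle).finrank_eq, finrank_span_singleton hu]
  have h3 : Module.finrank ℝ (S.g.OrthQuotient p u) + 1 = Module.finrank ℝ (S.g.orth p u) := by
    rw [← h2]
    exact Submodule.finrank_quotient_add_finrank _
  rw [← h1, ← h3]
  exact (Nat.add_sub_cancel _ 2).symm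

theorem jacobi_eq_zero_of_hasSingleEigenvalue (hE : 4 < Module.finrank ℝ E)
    (hL : S.g.IsLorentz) {p : M} (ht : S.g.val p (S.ξ 0 p) (S.ξ 0 p) < 0)
    (hμ : ∀ u ∈ S.phiNullCongruence p (S.ξ 0 p), ∃ μ : ℝ, S.HasSingleEigenvalue p u μ)
    {x y : TangentSpace 𝓘(ℝ, E) p} (hx : x ∈ (S.φ p).range) (hy : y ∈ (S.φ p).range)
    (hxy : S.g.val p x y = 0) : S.g.jacobi p x y = 0 := by
  have hε := S.sum_ε hL ht
  have hpos := fun y hy hy0 => S.pos_of_mem_range hL ht (x := y) hy hy0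
  suffices hscal : ∀ x ∈ (S.φ p).range, x ≠ 0 → ∃ k : ℝ, ∀ y ∈ (S.φ p).range,
      S.g.val p x y = 0 → S.g.curvature p y x x = (k * S.g.val p x x) • y from
    (S.isSCurvature hε p).jacobi_eq_zero_of_scalar hpos (S.exists_orthogonal hE p) hscal hx hy hxy
  intro x hx hx0
  have hxpos := hpos x hx hx0
  -- The null congruence set only involves unit vectors, so `x` is normalized and the result is
  -- scaled back by `r² = g(x, x)`.
  obtain ⟨r, hr0, hrr⟩ : ∃ r : ℝ, r ≠ 0 ∧ r * r = S.g.val p x x :=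
    ⟨_, (Real.sqrt_pos.2 hxpos).ne', Real.mul_self_sqrt hxpos.le⟩
  obtain ⟨v, hv⟩ : ∃ v : TangentSpace 𝓘(ℝ, E) p, v = r⁻¹ • x := ⟨_, rfl⟩
  have hvm : v ∈ (S.φ p).range := hv ▸ Submodule.smul_mem _ _ hx
  have hvv : S.g.val p v v = 1 := by
    rw [hv, map_smul, map_smul, smul_apply, smul_eq_mul, smul_eq_mul, ← hrr]
    field_simp
  have hxv : x = r • v := by rw [hv, smul_smul, mul_inv_cancel₀ hr0, one_smul]
  obtain ⟨μ, hμ⟩ := hμ (S.ξ 0 p + v) ⟨v, ⟨S.metric_ξ_of_mem_range hvm 0, hvv, hvm⟩, rfl⟩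
  refine ⟨μ - 1, fun y hy hxy => ?_⟩
  have hvy : S.g.val p v y = 0 := by
    rw [hv, map_smul, smul_apply, hxy, smul_zero]
  have h1 := S.jacobi_eq_smul hε hpos hvm hμ hy hvy
  have h2 : S.g.curvature p y (r • v) (r • v) = r • r • S.g.curvature p y v v :=
    ((S.isSCurvature hε p).smul_middle r y v (r • v)).trans
      (congrArg (r • ·) ((S.isSCurvature hε p).smul_right r y v v))
  have h3 : S.g.curvature p y v v = (μ - 1) • y := h1
  rw [← hrr, hxv, h2, h3]
  module

theorem jacobi_eq_zero_of_isSpaceForm (hL : S.g.IsLorentz) {p : M}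
    (ht : S.g.val p (S.ξ 0 p) (S.ξ 0 p) < 0) (hS : S.IsSpaceForm 0)
    {x y : TangentSpace 𝓘(ℝ, E) p} (hx : x ∈ (S.φ p).range) (hy : y ∈ (S.φ p).range) :
    S.g.jacobi p x y = 0 := by
  have H := S.isSCurvature (S.sum_ε hL ht) p
  refine H.jacobi_eq_zero_of_sectional (fun x hx => ?_) hx hy
  by_cases hx0 : x = 0
  · rw [hx0, map_zero]
  · have hxx := (S.pos_of_mem_range hL ht (x := x) hx hx0).ne'
    refine (div_eq_zero_iff.1 (hS p x hx hxx)).resolve_right ?_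
    have h1 : S.g.val p (S.φ p x) (S.φ p x) = S.g.val p x x := H.metric_φ_φ_of_mem hx x
    have h2 : S.g.val p x (S.φ p x) = 0 := H.metric_φ_self x
    rw [h1, h2]
    simpa using hxx

/-- The vectors `x` and `φx` are orthogonal, so the numerator of the sectional curvature involves
only `R(x, φx)φx = 0`. -/
theorem isSpaceForm_of_jacobi_eq_zero
    (hR : ∀ p, ∀ x ∈ (S.φ p).range, ∀ y ∈ (S.φ p).range, S.g.val p x y = 0 →
      S.g.jacobi p x y = 0) : S.IsSpaceForm 0 := by
  intro p x hx _
  have h1 : S.g.val p (S.φ p x) x = 0 :=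
    (S.g.symm p _ _).trans ((S.isGFFAt p).metric_φ_self x)
  have h2 : S.g.curvature p x (S.φ p x) (S.φ p x) = 0 := hR p _ ⟨x, rfl⟩ x hx h1
  rw [SemiRiemannianMetric.sectionalCurvature, h2, map_zero]
  simp

theorem isPhiNullOsserman_of_jacobi_eq_zero (hL : S.g.IsLorentz)
    (ht : ∀ p : M, S.g.val p (S.ξ 0 p) (S.ξ 0 p) < 0)
    (hR : ∀ p, ∀ x ∈ (S.φ p).range, ∀ y ∈ (S.φ p).range, S.g.val p x y = 0 →
      S.g.jacobi p x y = 0) : S.IsPhiNullOsserman 0 := by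
  rintro p _ ⟨x, ⟨-, hxx, hx⟩, rfl⟩ _ ⟨y, ⟨-, hyy, hy⟩, rfl⟩
  rw [S.jacobiBar_eq_id hL (ht p) hx hxx (hR p x hx),
    S.jacobiBar_eq_id hL (ht p) hy hyy (hR p y hy)]
  have hxn := S.phiNullCongruence_null (ht p) hx hxx
  have hyn := S.phiNullCongruence_null (ht p) hy hyy
  -- The two operators are identities on different quotients of the same dimension, so any linear
  -- isomorphism conjugates one into the other.
  have e := LinearEquiv.ofFinrankEq _ _ ((S.finrank_orthQuotient hxn.1 hxn.2).trans
    (S.finrank_orthQuotient hyn.1 hyn.2).symm)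
  rw [← e.charpoly_conj LinearMap.id, LinearEquiv.conj_id]

theorem hasSingleEigenvalue_one_of_jacobi_eq_zero (hL : S.g.IsLorentz) {p : M}
    (ht : S.g.val p (S.ξ 0 p) (S.ξ 0 p) < 0)
    (hR : ∀ x ∈ (S.φ p).range, ∀ y ∈ (S.φ p).range, S.g.val p x y = 0 → S.g.jacobi p x y = 0)
    {u : TangentSpace 𝓘(ℝ, E) p} (hu : u ∈ S.phiNullCongruence p (S.ξ 0 p)) :
    S.HasSingleEigenvalue p u 1 := by
  obtain ⟨x, ⟨-, hxx, hx⟩, rfl⟩ := hu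
  refine S.hasSingleEigenvalue_one (S.sum_ε hL ht) hx (fun h0 => ?_) (hR x hx)
  rw [h0, map_zero] at hxx
  exact zero_ne_one hxx

end IndefiniteSStructure
end Main
end LorentzS

end

theorem proposition5p9 (n : ℕ) (hn : 1 < n)
    {M : Type*} [TopologicalSpace M] [T2Space M] [SecondCountableTopology M] [ConnectedSpace M]
    [ChartedSpace (EuclideanSpace ℝ (Fin (2 * n + 2))) M] [IsManifold (𝓡 (2 * n + 2)) ∞ M]
    (S : LorentzS.IndefiniteSStructure (EuclideanSpace ℝ (Fin (2 * n + 2))) M 2)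
    (hLorentz : S.g.IsLorentz)
    (htimelike : ∀ p : M, S.g.val p (S.ξ 0 p) (S.ξ 0 p) < 0) :
    ((S.IsPhiNullOsserman 0 ∧
        ∀ p : M, ∀ u ∈ S.phiNullCongruence p (S.ξ 0 p), ∃ μ : ℝ, S.HasSingleEigenvalue p u μ) ↔
      S.IsSpaceForm 0) ∧
    ((S.IsPhiNullOsserman 0 ∧
        ∀ p : M, ∀ u ∈ S.phiNullCongruence p (S.ξ 0 p), ∃ μ : ℝ, S.HasSingleEigenvalue p u μ) →
      ∀ p : M, ∀ u ∈ S.phiNullCongruence p (S.ξ 0 p), S.HasSingleEigenvalue p u 1) := by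
  -- The hypothesis `n > 1` gives dimension at least 6.
  have hE : 4 < Module.finrank ℝ (EuclideanSpace ℝ (Fin (2 * n + 2))) := by
    rw [finrank_euclideanSpace_fin]; omega
  have hR := fun (h : ∀ p : M, ∀ u ∈ S.phiNullCongruence p (S.ξ 0 p),
      ∃ μ : ℝ, S.HasSingleEigenvalue p u μ) p x hx y hy hxy =>
    S.jacobi_eq_zero_of_hasSingleEigenvalue hE hLorentz (htimelike p) (h p) (x := x) (y := y)
      hx hy hxy
  refine ⟨⟨fun h => S.isSpaceForm_of_jacobi_eq_zero (hR h.2), fun h => ?_⟩, fun h p u hu =>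
    S.hasSingleEigenvalue_one_of_jacobi_eq_zero hLorentz (htimelike p) (hR h.2 p) hu⟩
  have hR' := fun p x hx y hy (_ : S.g.val p x y = 0) =>
    S.jacobi_eq_zero_of_isSpaceForm hLorentz (htimelike p) h (x := x) (y := y) hx hy
  exact ⟨S.isPhiNullOsserman_of_jacobi_eq_zero hLorentz htimelike hR', fun p u hu =>
    ⟨1, S.hasSingleEigenvalue_one_of_jacobi_eq_zero hLorentz (htimelike p) (hR' p) hu⟩⟩
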